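/- **Setting.** All complex manifolds are finite-dimensional, Hausdorff and second countable. A *holomorphic symplectic Morita equivalence* between holomorphic Poisson manifolds $(X_+,\sigma_+)$ and $(X_-,\sigma_-)$ is a holomorphic symplectic manifold $(Z,\Omega)$ with holomorphic surjective submersions $\pi_\pm : Z\to X_\pm$ that have connected and simply connected fibres, such that $\pi_+$ is Poisson and $\pi_-$ is anti-Poisson, $\ker d\pi_+$ and $\ker d\pi_-$ are the symplectic orthogonals of each other, and $\pi_\pm$ are complete: whenever a smooth real function $f$ on $X_\pm$ has complete Hamiltonian vector field for the real Poisson structure $Q_\pm=-4\,\mathrm{Im}\,\sigma_\pm$, the Hamiltonian vector field of $\pi_\pm^*f$ with respect to the real symplectic form $\mathrm{Im}\,\Omega$ is complete. A *brane bisection* is a smooth submanifold $\mathcal L\subset Z$ that is Lagrangian for $\mathrm{Im}\,\Omega$ and is (the image of) a smooth section of both $\pi_+$ and $\pi_-$. Let $L$ be a complex manifold (for example a holomorphic Lagrangian submanifold of $Z$, as the zero section of $T^*L$), let $T^*L$ be its holomorphic cotangent bundle, viewed as the bundle of $(1,0)$-forms, and let $\Omega_0=d\theta$ be its canonical holomorphic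 symplectic form, where $\theta_\alpha(v)=\alpha(d\mathrm{pr}\,v)$ for the projection $\mathrm{pr}:T^*L\to L$. A *holomorphic Darboux chart* $\varphi:(T^*L,\Omega_0)\to(Z,\Omega)$ is a biholomorphism from an open subset $W$ of $T^*L$ onto an open subset of $Z$ with $\varphi^*\Omega=\Omega_0$. It is *generic* for $\mathcal L$ if in the chart $\mathcal L$ is the graph of a smooth $(1,0)$-form $\eta$ on $L$, i.e. $\{p\in W:\varphi(p)\in\mathcal L\}=\{\eta_x : x\in L\}$. For $U\subseteq L$ open and $\eta$ a $(1,0)$-form on $U$, we write $\mathcal L|_U=\mathrm{Graph}(\eta)$ if $\{p\in W:\varphi(p)\in\mathcal L,\ \mathrm{pr}(p)\in U\}=\{\eta_x: x\in U\}$. **Theorem 5.1.** Let $(Z,\Omega,\mathcal L)$ be a holomorphic symplectic Morita equivalence with brane bisection, and let $\varphi:(T^*L,\Omega_0)\to(Z,\Omega)$ be a generic holomorphic Darboux chart. Then for every simply connected (in particular connected and non-empty) open subset $U\subseteq L$ (so for $U=L$ if $L$ itself is simply connected) there is a smooth function $K:U\to\mathbb R$, unique up to an additive real constant, such that $$\mathcal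 L|_U=\mathrm{Graph}(-i\,\partial K).$$ That is, such a $K$ exists, and a smooth function $K':U\to\mathbb R$ has the same property if and only if $K'-K$ is constant. Moreover the form $F=\Omega|_{\mathcal L}$, pulled back to $U$ along the parametrization $x\mapsto\varphi(-i\,\partial K_x)$ of $\mathcal L$ in the chart, is $$F=i\,\partial\bar\partial K .$$ The function $K$ is called the *generalized Kähler potential*. -/

import Mathlib

open scoped Manifold ContDiff Topology
open Bundle

noncomputable section

namespace GKPotential

/-! ### Differential forms on manifolds without boundary

Tangent spaces are identified with the model space through the preferred chart at the point,
which is Mathlib's convention. -/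

section Forms

/-- (Not necessarily continuous) `F`-valued differential `k`-forms on `M`. -/
abbrev DiffForm {𝕜 : Type*} [NontriviallyNormedField 𝕜]
    {E : Type*} [NormedAddCommGroup E] [NormedSpace 𝕜 E] {H : Type*} [TopologicalSpace H]
    (I : ModelWithCorners 𝕜 E H) (M : Type*) [TopologicalSpace M] [ChartedSpace H M]
    (F : Type*) [NormedAddCommGroup F] [NormedSpace 𝕜 F] (k : ℕ) :=
  (x : M) → TangentSpace I x [⋀^Fin k]→L[𝕜] F

/-- The expression of a form in the preferred chart at `c`: its pullback to the model vector space
along the inverse of that chart. -/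
def chartForm {𝕜 : Type*} [NontriviallyNormedField 𝕜]
    {E : Type*} [NormedAddCommGroup E] [NormedSpace 𝕜 E] {H : Type*} [TopologicalSpace H]
    (I : ModelWithCorners 𝕜 E H) {M : Type*} [TopologicalSpace M] [ChartedSpace H M]
    {F : Type*} [NormedAddCommGroup F] [NormedSpace 𝕜 F] {k : ℕ}
    (c : M) (α : DiffForm I M F k) (y : E) : E [⋀^Fin k]→L[𝕜] F :=
  (α ((extChartAt I c).symm y)).compContinuousLinearMap
    (mfderiv 𝓘(𝕜, E) I (extChartAt I c).symm y)

/-- A form is of class `C^n` if its expressions in charts are. -/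
def IsContDiffForm {𝕜 : Type*} [NontriviallyNormedField 𝕜]
    {E : Type*} [NormedAddCommGroup E] [NormedSpace 𝕜 E] {H : Type*} [TopologicalSpace H]
    (I : ModelWithCorners 𝕜 E H) {M : Type*} [TopologicalSpace M] [ChartedSpace H M]
    {F : Type*} [NormedAddCommGroup F] [NormedSpace 𝕜 F] {k : ℕ}
    (n : WithTop ℕ∞) (α : DiffForm I M F k) : Prop :=
  ∀ c : M, ContDiffOn 𝕜 n (chartForm I c α) (extChartAt I c).target

/-- The exterior derivative, computed at each point in the preferred chart at that point. -/
def extD {𝕜 : Type*} [NontriviallyNormedField 𝕜]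
    {E : Type*} [NormedAddCommGroup E] [NormedSpace 𝕜 E] {H : Type*} [TopologicalSpace H]
    (I : ModelWithCorners 𝕜 E H) {M : Type*} [TopologicalSpace M] [ChartedSpace H M]
    {F : Type*} [NormedAddCommGroup F] [NormedSpace 𝕜 F] {k : ℕ}
    (α : DiffForm I M F k) : DiffForm I M F (k + 1) :=
  fun x => (extDeriv (chartForm I x α) (extChartAt I x x) : E [⋀^Fin (k + 1)]→L[𝕜] F)

/-- The pullback `f^*α` of a form along a map. -/
def pullback {𝕜 : Type*} [NontriviallyNormedField 𝕜]
    {E : Type*} [NormedAddCommGroup E] [NormedSpace 𝕜 E] {H : Type*} [TopologicalSpace H]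
    (I : ModelWithCorners 𝕜 E H) {M : Type*} [TopologicalSpace M] [ChartedSpace H M]
    {E' : Type*} [NormedAddCommGroup E'] [NormedSpace 𝕜 E'] {H' : Type*} [TopologicalSpace H']
    (I' : ModelWithCorners 𝕜 E' H') {M' : Type*} [TopologicalSpace M'] [ChartedSpace H' M']
    {F : Type*} [NormedAddCommGroup F] [NormedSpace 𝕜 F] {k : ℕ}
    (f : M → M') (α : DiffForm I' M' F k) : DiffForm I M F k :=
  fun x => (α (f x)).compContinuousLinearMap (mfderiv I I' f x)

/-- A `1`-form, given as a field of linear functionals, as a `DiffForm`. -/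
def oneForm {𝕜 : Type*} [NontriviallyNormedField 𝕜]
    {E : Type*} [NormedAddCommGroup E] [NormedSpace 𝕜 E] {H : Type*} [TopologicalSpace H]
    (I : ModelWithCorners 𝕜 E H) {M : Type*} [TopologicalSpace M] [ChartedSpace H M]
    {F : Type*} [NormedAddCommGroup F] [NormedSpace 𝕜 F]
    (a : (x : M) → TangentSpace I x →L[𝕜] F) : DiffForm I M F 1 :=
  fun x => ContinuousAlternatingMap.ofSubsingleton 𝕜 (TangentSpace I x) F (0 : Fin 1) (a x)

/-- A complex multilinear alternating form, regarded as a real one. -/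
def restrictReal {E : Type*} [NormedAddCommGroup E] [NormedSpace ℂ E] {k : ℕ}
    (β : E [⋀^Fin k]→L[ℂ] ℂ) : E [⋀^Fin k]→L[ℝ] ℂ :=
  β.restrictScalars ℝ

/-- The complex-valued real form underlying a form of type `(k,0)`. -/
def realForm {E : Type*} [NormedAddCommGroup E] [NormedSpace ℂ E]
    {M : Type*} [TopologicalSpace M] [ChartedSpace E M] {k : ℕ}
    (α : DiffForm 𝓘(ℂ, E) M ℂ k) : DiffForm 𝓘(ℝ, E) M ℂ k :=
  fun x => restrictReal (E := E) (α x)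

/-- The real form `Im α`, for `α` of type `(k,0)`. -/
def imForm {E : Type*} [NormedAddCommGroup E] [NormedSpace ℂ E]
    {M : Type*} [TopologicalSpace M] [ChartedSpace E M] {k : ℕ}
    (α : DiffForm 𝓘(ℂ, E) M ℂ k) : DiffForm 𝓘(ℝ, E) M ℝ k :=
  fun x => Complex.imCLM.compContinuousAlternatingMap (realForm α x)

end Forms

/-! ### Types of forms and the Dolbeault operators -/

section Dolbeault

/-- Multiplication by `i` as a real-linear map (the complex structure of a tangent space). -/
def mulI (E : Type*) [NormedAddCommGroup E] [NormedSpace ℂ E] : E →L[ℝ] E :=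
  Complex.I • ContinuousLinearMap.id ℝ E

/-- The `(1,0)`-part `v ↦ (a v - i a (i v)) / 2` of a real covector `a`. -/
def part10 {E : Type*} [NormedAddCommGroup E] [NormedSpace ℂ E] (a : E →L[ℝ] ℝ) : E →L[ℂ] ℂ :=
  (1 / 2 : ℂ) • (StrongDual.extendRCLike a : E →L[ℂ] ℂ)

/-- The `(0,1)`-part `v ↦ (a v + i a (i v)) / 2` of a real covector `a`. -/
def part01 {E : Type*} [NormedAddCommGroup E] [NormedSpace ℂ E] (a : E →L[ℝ] ℝ) : E →L[ℝ] ℂ :=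
  (1 / 2 : ℂ) • (Complex.ofRealCLM.comp a
    + Complex.I • (Complex.ofRealCLM.comp a).comp (mulI E))

/-- The `(1,1)`-part `(v, w) ↦ (β(v, w) + β(i v, i w)) / 2` of a complex-valued `2`-form. -/
def part11 {E : Type*} [NormedAddCommGroup E] [NormedSpace ℂ E]
    (β : E [⋀^Fin 2]→L[ℝ] ℂ) : E [⋀^Fin 2]→L[ℝ] ℂ :=
  (1 / 2 : ℂ) • (β + β.compContinuousLinearMap (mulI E))

/-- `∂K`, the `(1,0)`-part of `dK`, for a real-valued function `K` on a complex manifold. -/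
def del {E : Type*} [NormedAddCommGroup E] [NormedSpace ℂ E]
    {M : Type*} [TopologicalSpace M] [ChartedSpace E M]
    (K : M → ℝ) (x : M) : TangentSpace 𝓘(ℂ, E) x →L[ℂ] ℂ :=
  part10 (E := E) (mfderiv 𝓘(ℝ, E) 𝓘(ℝ) K x)

/-- `∂̄K`, the `(0,1)`-part of `dK`, for a real-valued function `K` on a complex manifold. -/
def delBar {E : Type*} [NormedAddCommGroup E] [NormedSpace ℂ E]
    {M : Type*} [TopologicalSpace M] [ChartedSpace E M]
    (K : M → ℝ) (x : M) : TangentSpace 𝓘(ℝ, E) x →L[ℝ] ℂ :=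
  part01 (E := E) (mfderiv 𝓘(ℝ, E) 𝓘(ℝ) K x)

/-- `∂∂̄K`: on forms of type `(0,1)`, the operator `∂` is the `(1,1)`-part of `d`. -/
def delDelBar {E : Type*} [NormedAddCommGroup E] [NormedSpace ℂ E]
    {M : Type*} [TopologicalSpace M] [ChartedSpace E M]
    (K : M → ℝ) : DiffForm 𝓘(ℝ, E) M ℂ 2 :=
  fun x => part11 (E := E) (extD 𝓘(ℝ, E) (oneForm 𝓘(ℝ, E) (delBar (E := E) K)) x)

end Dolbeault

/-! ### Holomorphic symplectic and holomorphic Poisson manifolds -/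

section Structures

/-- `Ω` is a holomorphic symplectic form: a holomorphic, closed, nondegenerate `(2,0)`-form. -/
structure IsHolomorphicSymplectic {E : Type*} [NormedAddCommGroup E] [NormedSpace ℂ E]
    {Z : Type*} [TopologicalSpace Z] [ChartedSpace E Z] (Ω : DiffForm 𝓘(ℂ, E) Z ℂ 2) : Prop where
  holomorphic : IsContDiffForm 𝓘(ℂ, E) ω Ω
  closed : ∀ z : Z, extD 𝓘(ℂ, E) Ω z = 0
  nondegenerate : ∀ (z : Z) (v : TangentSpace 𝓘(ℂ, E) z),
    (∀ w : TangentSpace 𝓘(ℂ, E) z, Ω z ![v, w] = 0) → v = 0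

/-- Fields of bivectors of type `(2,0)`, as alternating forms on the holomorphic cotangent
spaces. -/
abbrev BivectorField (E : Type*) [NormedAddCommGroup E] [NormedSpace ℂ E]
    (X : Type*) [TopologicalSpace X] [ChartedSpace E X] :=
  (x : X) → (TangentSpace 𝓘(ℂ, E) x →L[ℂ] ℂ) [⋀^Fin 2]→ₗ[ℂ] ℂ

/-- The bracket `{f, g} = σ(df, dg)`. -/
def bracket {E : Type*} [NormedAddCommGroup E] [NormedSpace ℂ E]
    {X : Type*} [TopologicalSpace X] [ChartedSpace E X]
    (σ : BivectorField E X) (f g : X → ℂ) (x : X) : ℂ :=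
  σ x ![mfderiv 𝓘(ℂ, E) 𝓘(ℂ) f x, mfderiv 𝓘(ℂ, E) 𝓘(ℂ) g x]

/-- `σ` is a holomorphic Poisson structure: its bracket preserves the sheaf of holomorphic
functions and satisfies the Jacobi identity there. -/
structure IsHolomorphicPoisson {E : Type*} [NormedAddCommGroup E] [NormedSpace ℂ E]
    {X : Type*} [TopologicalSpace X] [ChartedSpace E X] (σ : BivectorField E X) : Prop where
  holomorphic : ∀ (V : Set X) (f g : X → ℂ), IsOpen V →
    ContMDiffOn 𝓘(ℂ, E) 𝓘(ℂ) ω f V → ContMDiffOn 𝓘(ℂ, E) 𝓘(ℂ) ω g V →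
    ContMDiffOn 𝓘(ℂ, E) 𝓘(ℂ) ω (bracket σ f g) V
  jacobi : ∀ (V : Set X) (f g h : X → ℂ), IsOpen V →
    ContMDiffOn 𝓘(ℂ, E) 𝓘(ℂ) ω f V → ContMDiffOn 𝓘(ℂ, E) 𝓘(ℂ) ω g V →
    ContMDiffOn 𝓘(ℂ, E) 𝓘(ℂ) ω h V →
    ∀ x ∈ V, bracket σ f (bracket σ g h) x + bracket σ g (bracket σ h f) x
      + bracket σ h (bracket σ f g) x = 0

/-- The real Poisson bivector `Q = -4 Im σ` on real covectors; the `(2,0)`-bivector `σ` only sees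
the `(1,0)`-parts. -/
def realPoisson {E : Type*} [NormedAddCommGroup E] [NormedSpace ℂ E]
    {X : Type*} [TopologicalSpace X] [ChartedSpace E X] (σ : BivectorField E X)
    (x : X) (a b : E →L[ℝ] ℝ) : ℝ :=
  -4 * (σ x ![part10 (E := E) a, part10 (E := E) b]).im

/-- A vector field is complete if an integral curve defined for all times starts at each point. -/
def IsCompleteField {E : Type*} [NormedAddCommGroup E] [NormedSpace ℝ E]
    {M : Type*} [TopologicalSpace M] [ChartedSpace E M]
    (V : (x : M) → TangentSpace 𝓘(ℝ, E) x) : Prop :=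
  ∀ x : M, ∃ γ : ℝ → M, γ 0 = x ∧ IsMIntegralCurve (I := 𝓘(ℝ, E)) γ V

/-- `pr : (Z, Ω) → (X, ε σ)` is Poisson (`ε = 1`) or anti-Poisson (`ε = -1`), where `(Z, Ω)` has the
Poisson structure inverse to `Ω`: the bracket of two covectors `Ω(v, ·)` and `Ω(w, ·)` of `Z` is
`Ω(v, w)`, so that `dp ∧ dq` corresponds to `{p, q} = 1`. -/
def IsPoissonMap {E EX : Type*} [NormedAddCommGroup E] [NormedSpace ℂ E]
    [NormedAddCommGroup EX] [NormedSpace ℂ EX]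
    {Z X : Type*} [TopologicalSpace Z] [ChartedSpace E Z] [TopologicalSpace X] [ChartedSpace EX X]
    (Ω : DiffForm 𝓘(ℂ, E) Z ℂ 2) (ε : ℂ) (σ : BivectorField EX X) (pr : Z → X) : Prop :=
  ∀ (z : Z) (α β : TangentSpace 𝓘(ℂ, EX) (pr z) →L[ℂ] ℂ) (v w : TangentSpace 𝓘(ℂ, E) z),
    (∀ u, Ω z ![v, u] = α (mfderiv 𝓘(ℂ, E) 𝓘(ℂ, EX) pr z u)) →
    (∀ u, Ω z ![w, u] = β (mfderiv 𝓘(ℂ, E) 𝓘(ℂ, EX) pr z u)) →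
    Ω z ![v, w] = ε * σ (pr z) ![α, β]

/-- `pr : (Z, Im Ω) → (X, Q)`, with `Q = -4 Im σ`, is complete: whenever the Hamiltonian vector
field of a smooth function `f` on `X` is complete, so is that of `f ∘ pr` on `Z`. -/
def IsCompleteMap {E EX : Type*} [NormedAddCommGroup E] [NormedSpace ℂ E]
    [NormedAddCommGroup EX] [NormedSpace ℂ EX]
    {Z X : Type*} [TopologicalSpace Z] [ChartedSpace E Z] [TopologicalSpace X] [ChartedSpace EX X]
    (Ω : DiffForm 𝓘(ℂ, E) Z ℂ 2) (σ : BivectorField EX X) (pr : Z → X) : Prop :=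
  ∀ (f : X → ℝ) (V : (x : X) → TangentSpace 𝓘(ℝ, EX) x) (W : (z : Z) → TangentSpace 𝓘(ℝ, E) z),
    ContMDiff 𝓘(ℝ, EX) 𝓘(ℝ) ∞ f →
    (∀ (x : X) (b : EX →L[ℝ] ℝ), b (V x) = realPoisson σ x (mfderiv 𝓘(ℝ, EX) 𝓘(ℝ) f x) b) →
    (∀ (z : Z) (u : TangentSpace 𝓘(ℝ, E) z),
      imForm Ω z ![W z, u] = mfderiv 𝓘(ℝ, E) 𝓘(ℝ) (f ∘ pr) z u) →
    IsCompleteField V → IsCompleteField W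

/-- A holomorphic surjective submersion with connected and simply connected fibres. -/
structure IsFibration {E EX : Type*} [NormedAddCommGroup E] [NormedSpace ℂ E]
    [NormedAddCommGroup EX] [NormedSpace ℂ EX]
    {Z X : Type*} [TopologicalSpace Z] [ChartedSpace E Z] [TopologicalSpace X] [ChartedSpace EX X]
    (pr : Z → X) : Prop where
  holomorphic : ContMDiff 𝓘(ℂ, E) 𝓘(ℂ, EX) ω pr
  surjective : Function.Surjective pr
  submersion : ∀ z : Z, Function.Surjective (mfderiv 𝓘(ℂ, E) 𝓘(ℂ, EX) pr z)
  fibres : ∀ x : X, SimplyConnectedSpace (pr ⁻¹' {x})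

/-- `(Z, Ω)` with the projections `πp : Z → Xp` and `πm : Z → Xm` is a holomorphic symplectic
Morita equivalence between the holomorphic Poisson manifolds `(Xp, σp)` and `(Xm, σm)`. -/
structure IsMoritaEquivalence {E Ep Em : Type*} [NormedAddCommGroup E] [NormedSpace ℂ E]
    [NormedAddCommGroup Ep] [NormedSpace ℂ Ep] [NormedAddCommGroup Em] [NormedSpace ℂ Em]
    {Z Xp Xm : Type*} [TopologicalSpace Z] [ChartedSpace E Z]
    [TopologicalSpace Xp] [ChartedSpace Ep Xp] [TopologicalSpace Xm] [ChartedSpace Em Xm]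
    (Ω : DiffForm 𝓘(ℂ, E) Z ℂ 2) (σp : BivectorField Ep Xp) (σm : BivectorField Em Xm)
    (πp : Z → Xp) (πm : Z → Xm) : Prop where
  symplectic : IsHolomorphicSymplectic Ω
  poisson_plus : IsHolomorphicPoisson σp
  poisson_minus : IsHolomorphicPoisson σm
  fibration_plus : IsFibration (E := E) (EX := Ep) πp
  fibration_minus : IsFibration (E := E) (EX := Em) πm
  isPoisson_plus : IsPoissonMap Ω 1 σp πp
  isPoisson_minus : IsPoissonMap Ω (-1) σm πm
  /-- The vertical distributions are the symplectic orthogonals of each other. -/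
  orthogonal : ∀ (z : Z) (v : TangentSpace 𝓘(ℂ, E) z),
    mfderiv 𝓘(ℂ, E) 𝓘(ℂ, Ep) πp z v = 0 ↔
      ∀ w : TangentSpace 𝓘(ℂ, E) z, mfderiv 𝓘(ℂ, E) 𝓘(ℂ, Em) πm z w = 0 → Ω z ![v, w] = 0
  complete_plus : IsCompleteMap Ω σp πp
  complete_minus : IsCompleteMap Ω σm πm

/-- `𝓛` is the image of a smooth section of `pr : Z → X` that is Lagrangian for `Im Ω`: its tangent
spaces are their own orthogonals with respect to `Im Ω`. -/
def IsLagrangianSection {E EX : Type*} [NormedAddCommGroup E] [NormedSpace ℂ E]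
    [NormedAddCommGroup EX] [NormedSpace ℂ EX]
    {Z X : Type*} [TopologicalSpace Z] [ChartedSpace E Z] [TopologicalSpace X] [ChartedSpace EX X]
    (Ω : DiffForm 𝓘(ℂ, E) Z ℂ 2) (pr : Z → X) (𝓛 : Set Z) : Prop :=
  ∃ s : X → Z, ContMDiff 𝓘(ℝ, EX) 𝓘(ℝ, E) ∞ s ∧ (∀ x, pr (s x) = x) ∧ Set.range s = 𝓛 ∧
    ∀ (x : X) (w : TangentSpace 𝓘(ℝ, E) (s x)),
      w ∈ Set.range (mfderiv 𝓘(ℝ, EX) 𝓘(ℝ, E) s x) ↔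
        ∀ v : TangentSpace 𝓘(ℝ, EX) x,
          imForm Ω (s x) ![mfderiv 𝓘(ℝ, EX) 𝓘(ℝ, E) s x v, w] = 0

/-- `𝓛` is a brane bisection: a smooth submanifold of `Z` that is Lagrangian for `Im Ω` and a
section of both projections. (The image of a smooth section of a submersion is an embedded
submanifold.) -/
def IsBraneBisection {E Ep Em : Type*} [NormedAddCommGroup E] [NormedSpace ℂ E]
    [NormedAddCommGroup Ep] [NormedSpace ℂ Ep] [NormedAddCommGroup Em] [NormedSpace ℂ Em]
    {Z Xp Xm : Type*} [TopologicalSpace Z] [ChartedSpace E Z]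
    [TopologicalSpace Xp] [ChartedSpace Ep Xp] [TopologicalSpace Xm] [ChartedSpace Em Xm]
    (Ω : DiffForm 𝓘(ℂ, E) Z ℂ 2) (πp : Z → Xp) (πm : Z → Xm) (𝓛 : Set Z) : Prop :=
  IsLagrangianSection (EX := Ep) Ω πp 𝓛 ∧ IsLagrangianSection (EX := Em) Ω πm 𝓛

end Structures

/-! ### The holomorphic cotangent bundle and Darboux charts -/

section Darboux

/-- The total space of the holomorphic cotangent bundle `T^*L`, i.e. of the bundle of
`(1,0)`-forms. -/
abbrev Cotangent (E : Type*) [NormedAddCommGroup E] [NormedSpace ℂ E]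
    (L : Type*) [TopologicalSpace L] [ChartedSpace E L] [IsManifold 𝓘(ℂ, E) ω L] :=
  TotalSpace (E →L[ℂ] ℂ) (fun x : L => TangentSpace 𝓘(ℂ, E) x →L[ℂ] Trivial L ℂ x)

/-- The tautological `1`-form `θ = p dq` on `T^*L`: `θ_α(v) = α(dπ v)`. -/
def tautologicalForm (E : Type*) [NormedAddCommGroup E] [NormedSpace ℂ E]
    (L : Type*) [TopologicalSpace L] [ChartedSpace E L] [IsManifold 𝓘(ℂ, E) ω L] :
    DiffForm (𝓘(ℂ, E).prod 𝓘(ℂ, E →L[ℂ] ℂ)) (Cotangent E L) ℂ 1 :=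
  oneForm (𝓘(ℂ, E).prod 𝓘(ℂ, E →L[ℂ] ℂ)) fun p =>
    ContinuousLinearMap.comp (p.2 : TangentSpace 𝓘(ℂ, E) p.1 →L[ℂ] ℂ)
      (mfderiv (𝓘(ℂ, E).prod 𝓘(ℂ, E →L[ℂ] ℂ)) 𝓘(ℂ, E)
        (fun q : Cotangent E L => q.proj) p)

/-- The canonical holomorphic symplectic form `Ω₀ = dθ = dp ∧ dq` on `T^*L`. -/
def canonicalForm (E : Type*) [NormedAddCommGroup E] [NormedSpace ℂ E]
    (L : Type*) [TopologicalSpace L] [ChartedSpace E L] [IsManifold 𝓘(ℂ, E) ω L] :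
    DiffForm (𝓘(ℂ, E).prod 𝓘(ℂ, E →L[ℂ] ℂ)) (Cotangent E L) ℂ 2 :=
  extD (𝓘(ℂ, E).prod 𝓘(ℂ, E →L[ℂ] ℂ)) (tautologicalForm E L)

/-- `φ` is a holomorphic Darboux chart `(T^*L, Ω₀) → (Z, Ω)`: a biholomorphism from an open subset
of `T^*L` onto an open subset of `Z` with `φ^*Ω = Ω₀`. -/
structure IsDarbouxChart {E EL : Type*} [NormedAddCommGroup E] [NormedSpace ℂ E]
    [NormedAddCommGroup EL] [NormedSpace ℂ EL]
    {Z L : Type*} [TopologicalSpace Z] [ChartedSpace E Z]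
    [TopologicalSpace L] [ChartedSpace EL L] [IsManifold 𝓘(ℂ, EL) ω L]
    (Ω : DiffForm 𝓘(ℂ, E) Z ℂ 2) (φ : OpenPartialHomeomorph (Cotangent EL L) Z) : Prop where
  holomorphic : ContMDiffOn (𝓘(ℂ, EL).prod 𝓘(ℂ, EL →L[ℂ] ℂ)) 𝓘(ℂ, E) ω φ φ.source
  holomorphic_symm : ContMDiffOn 𝓘(ℂ, E) (𝓘(ℂ, EL).prod 𝓘(ℂ, EL →L[ℂ] ℂ)) ω φ.symm φ.target
  symplectic : ∀ p ∈ φ.source,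
    pullback (𝓘(ℂ, EL).prod 𝓘(ℂ, EL →L[ℂ] ℂ)) 𝓘(ℂ, E) φ Ω p = canonicalForm EL L p

/-- The section of `T^*L` given by a `(1,0)`-form `η`. -/
def formSection {E : Type*} [NormedAddCommGroup E] [NormedSpace ℂ E]
    {L : Type*} [TopologicalSpace L] [ChartedSpace E L] [IsManifold 𝓘(ℂ, E) ω L]
    (η : (x : L) → TangentSpace 𝓘(ℂ, E) x →L[ℂ] ℂ) (x : L) : Cotangent E L :=
  ⟨x, η x⟩

/-- The subset `𝓛` of `Z`, seen in the chart `φ` and over the open subset `U` of `L`, is the graph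
of the `(1,0)`-form `η` (only the values of `η` on `U` matter). -/
def IsGraphOver {E : Type*} [NormedAddCommGroup E] [NormedSpace ℂ E]
    {Z L : Type*} [TopologicalSpace Z]
    [TopologicalSpace L] [ChartedSpace E L] [IsManifold 𝓘(ℂ, E) ω L]
    (φ : OpenPartialHomeomorph (Cotangent E L) Z) (𝓛 : Set Z) (U : Set L)
    (η : (x : L) → TangentSpace 𝓘(ℂ, E) x →L[ℂ] ℂ) : Prop :=
  {p : Cotangent E L | p ∈ φ.source ∧ φ p ∈ 𝓛 ∧ p.proj ∈ U} = formSection η '' U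

/-- The chart `φ` is generic for `𝓛`: in it, `𝓛` is the graph of a smooth `(1,0)`-form on `L`. -/
def IsGeneric {E : Type*} [NormedAddCommGroup E] [NormedSpace ℂ E]
    {Z L : Type*} [TopologicalSpace Z]
    [TopologicalSpace L] [ChartedSpace E L] [IsManifold 𝓘(ℂ, E) ω L]
    (φ : OpenPartialHomeomorph (Cotangent E L) Z) (𝓛 : Set Z) : Prop :=
  ∃ η : (x : L) → TangentSpace 𝓘(ℂ, E) x →L[ℂ] ℂ,
    ContMDiff 𝓘(ℝ, E) (𝓘(ℝ, E).prod 𝓘(ℝ, E →L[ℂ] ℂ)) ∞ (formSection η) ∧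
    IsGraphOver φ 𝓛 Set.univ η

end Darboux

end GKPotential

end

noncomputable section

/-! In the chart, `𝓛` is the graph of a smooth `(1,0)`-form `η`. A section pulls the tautological
form back to itself, so `Ω₀ = dθ` restricts to the graph as `dη` (`pullback_darboux_formSection`).
Since `𝓛` is Lagrangian for `Im Ω`, the real `1`-form `Im η` is closed
(`im_pullback_eq_zero_of_mem_lagrangian`). On a simply connected open `U` it is therefore exact, and
one can write `dK = -2 Im η` (`exists_primitive`).

A form of type `(1,0)` is determined by its imaginary part: the `(1,0)`-part of `-2 Im η` is `iη`,
so `-i ∂K = η` (`neg_I_smul_part10`). Conversely, `∂K` determines the real covector `dK`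
(`part10_injective`). As graphs coincide exactly when the forms do, the admissible potentials on `U`
are exactly the primitives of `-2 Im η`, and on a connected set these differ by constants.

Finally `F = dη = d(-i ∂K) = i ∂∂̄K`, which in a holomorphic chart reduces to the symmetry of the
Hessian of `K` (`extD_negIDel`).

Exactness combines the Poincaré lemma on balls in charts with a covering argument: germs of local
primitives form a covering space with discrete fibre `ℝ`, which has a global section over a simply
connected base. -/

namespace GKPotential

/-! ### Gluing of local primitives on simply connected spaces -/

section Gluing

/-- The real numbers with the discrete topology. -/
@[ext]
structure DiscreteReal where
  /-- The underlying real number. -/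
  val : ℝ

instance : TopologicalSpace DiscreteReal := ⊥

instance : DiscreteTopology DiscreteReal := ⟨rfl⟩

variable {X : Type*} [TopologicalSpace X]

theorem continuousAt_iff_eventually_eq {Y : Type*} [TopologicalSpace Y] [DiscreteTopology Y]
    {g : X → Y} {x : X} : ContinuousAt g x ↔ ∀ᶠ y in 𝓝 x, g y = g x := by
  simp only [ContinuousAt, nhds_discrete Y, Filter.tendsto_pure]

/-- The covering space of germs of functions that differ from the local functions `f x` by locally
constant functions. -/
def primitiveBundle (B : X → Set X) (f : X → X → ℝ) (hB : ∀ x, IsOpen (B x))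
    (hmem : ∀ x, x ∈ B x)
    (hf : ∀ i j, ∀ x ∈ B i ∩ B j, ∀ᶠ y in 𝓝 x, f i y - f j y = f i x - f j x) :
    FiberBundleCore X X DiscreteReal where
  baseSet := B
  isOpen_baseSet := hB
  indexAt := id
  mem_baseSet_at := hmem
  -- The coordinate `t` over index `i` stands for the germ `f i + t`; the same germ written as `f j
  -- + t'` has `t' = t + (f i x - f j x)`.
  coordChange i j x t := ⟨t.val + (f i x - f j x)⟩
  coordChange_self i x _ v := by
    ext
    simp
  continuousOn_coordChange i j := by
    -- The fibre is discrete, so continuity means being locally constant in `x` for fixed `t`, which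
    -- is the hypothesis `hf`.
    rintro ⟨x, t⟩ ⟨hx, -⟩
    refine ContinuousAt.continuousWithinAt ?_
    rw [continuousAt_iff_eventually_eq, nhds_prod_eq, nhds_discrete DiscreteReal]
    refine ((hf i j x hx).prod_mk (Filter.eventually_pure.2 (rfl : t = t))).mono ?_
    rintro ⟨y, s⟩ ⟨hy, hs⟩
    simp only at hy hs
    subst hs
    simp only [hy]
  coordChange_comp i j k x _ v := by
    ext
    simp only
    ring

/-- On a simply connected space, local functions whose differences are locally constant come from a
single function, up to locally constant functions. -/
theorem exists_of_locally_sub_eventually_const [SimplyConnectedSpace X]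
    [LocallyPathConnectedSpace X] (B : X → Set X) (f : X → X → ℝ) (hB : ∀ x, IsOpen (B x))
    (hmem : ∀ x, x ∈ B x)
    (hf : ∀ i j, ∀ x ∈ B i ∩ B j, ∀ᶠ y in 𝓝 x, f i y - f j y = f i x - f j x) :
    ∃ K : X → ℝ, ∀ x, ∀ᶠ y in 𝓝 x, K y - f x y = K x - f x x := by
  let C := primitiveBundle B f hB hmem hf
  have hcov : IsCoveringMap C.proj := FiberBundle.isCoveringMap (F := DiscreteReal) (E := C.Fiber)
  obtain ⟨x₀⟩ : Nonempty X := inferInstance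
  -- A global section is a lift of the identity, which exists because the base is simply connected
  -- and locally path connected.
  obtain ⟨S, ⟨-, hS⟩, -⟩ := hcov.existsUnique_continuousMap_lifts (ContinuousMap.id X) x₀
    (⟨x₀, (⟨0⟩ : DiscreteReal)⟩ : C.TotalSpace) rfl
  have hS' : ∀ x, (S x).proj = x := fun x => congrFun hS x
  -- `K x` is the value at `x` of the germ chosen by `S`. The coordinate of `S` in the
  -- trivialization at `x` is then `K - f x`, and it is locally constant because the fibre is
  -- discrete.
  refine ⟨fun x => (S x).2.val + f (S x).proj x, fun x => ?_⟩
  have hcont : ContinuousAt (fun y => (C.localTriv x (S y)).2) x := by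
    have h1 : ContinuousAt (C.localTriv x) (S x) :=
      (C.localTriv x).continuousAt (by
        rw [Trivialization.mem_source]
        change (S x).proj ∈ B x
        rw [hS']; exact hmem x)
    exact continuousAt_snd.comp (ContinuousAt.comp (f := fun y => S y) h1 S.continuous.continuousAt)
  rw [continuousAt_iff_eventually_eq] at hcont
  filter_upwards [hcont] with y hy
  have key : ∀ z, (C.localTriv x (S z)).2.val = (S z).2.val + (f (S z).proj z - f x z) :=
    fun z => by
      change (S z).2.val + (f (S z).proj (S z).proj - f x (S z).proj) = _
      rw [hS']
  have h2 := (key y).symm.trans ((congrArg DiscreteReal.val hy).trans (key x))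
  linarith

end Gluing

/-! ### Exterior derivatives of one-forms -/

section OneForms

theorem extDeriv_ofSubsingleton_apply {𝕜 : Type*} [NontriviallyNormedField 𝕜]
    {E F : Type*} [NormedAddCommGroup E] [NormedSpace 𝕜 E] [NormedAddCommGroup F] [NormedSpace 𝕜 F]
    {a : E → E →L[𝕜] F} {y : E} (ha : DifferentiableAt 𝕜 a y) (v w : E) :
    extDeriv (fun z => ContinuousAlternatingMap.ofSubsingleton 𝕜 E F (0 : Fin 1) (a z)) y ![v, w]
      = fderiv 𝕜 a y v w - fderiv 𝕜 a y w v := by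
  have h : DifferentiableAt 𝕜
      (fun z => ContinuousAlternatingMap.ofSubsingleton 𝕜 E F (0 : Fin 1) (a z)) y :=
    (ContinuousAlternatingMap.ofSubsingletonLIE (𝕜 := 𝕜) (E := E) (F := F)
      (0 : Fin 1)).differentiable.differentiableAt.comp
      y ha
  have hv : ∀ u, HasFDerivAt (fun z => a z u) ((fderiv 𝕜 a y).flip u) y := fun u => by
    simpa using! ha.hasFDerivAt.clm_apply (hasFDerivAt_const u y)
  rw [extDeriv_apply h, Fin.sum_univ_two]
  simp [Fin.removeNth, (hv v).fderiv, (hv w).fderiv, sub_eq_add_neg]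

end OneForms

/-! ### Change of charts for one-forms. -/

section LocalRep

variable {𝕜 : Type*} [NontriviallyNormedField 𝕜]
  {E : Type*} [NormedAddCommGroup E] [NormedSpace 𝕜 E]
  {M : Type*} [TopologicalSpace M] [ChartedSpace E M]
  {F : Type*} [NormedAddCommGroup F] [NormedSpace 𝕜 F]

/-- The expression of a `1`-form in the preferred chart at `c`, as a field of functionals. -/
def localRep (c : M) (a : (x : M) → TangentSpace 𝓘(𝕜, E) x →L[𝕜] F) (y : E) : E →L[𝕜] F :=
  (a ((extChartAt 𝓘(𝕜, E) c).symm y)).comp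
    (mfderiv 𝓘(𝕜, E) 𝓘(𝕜, E) (extChartAt 𝓘(𝕜, E) c).symm y)

theorem mdifferentiableAt_extChartAt_symm_of_mem [IsManifold 𝓘(𝕜, E) 1 M] {c : M} {y : E}
    (hy : y ∈ (extChartAt 𝓘(𝕜, E) c).target) :
    MDifferentiableAt 𝓘(𝕜, E) 𝓘(𝕜, E) (extChartAt 𝓘(𝕜, E) c).symm y := by
  have := mdifferentiableWithinAt_extChartAt_symm hy
  rwa [ModelWithCorners.range_eq_univ, mdifferentiableWithinAt_univ] at this

theorem contDiffAt_coordChange {n : WithTop ℕ∞} [IsManifold 𝓘(𝕜, E) n M] {c x z : M}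
    (hc : z ∈ (extChartAt 𝓘(𝕜, E) c).source) (hx : z ∈ (extChartAt 𝓘(𝕜, E) x).source) :
    ContDiffAt 𝕜 n (extChartAt 𝓘(𝕜, E) x ∘ (extChartAt 𝓘(𝕜, E) c).symm)
      (extChartAt 𝓘(𝕜, E) c z) := by
  have := contDiffWithinAt_ext_coord_change (I := 𝓘(𝕜, E)) (n := n) x c
    (y := extChartAt 𝓘(𝕜, E) c z) (by
      rw [PartialEquiv.trans_source'', PartialEquiv.symm_symm, PartialEquiv.symm_target]
      exact Set.mem_image_of_mem _ ⟨hc, hx⟩)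
  rwa [ModelWithCorners.range_eq_univ, contDiffWithinAt_univ] at this

/-- The transformation law of a `1`-form under the coordinate change `τ`: near the point the inverse
chart at `c` equals the inverse chart at `x` composed with `τ`, so the chain rule applies. -/
theorem localRep_eventuallyEq [IsManifold 𝓘(𝕜, E) 1 M] (c : M)
    (a : (x : M) → TangentSpace 𝓘(𝕜, E) x →L[𝕜] F) {x : M}
    (hx : x ∈ (extChartAt 𝓘(𝕜, E) c).source) :
    localRep c a =ᶠ[𝓝 (extChartAt 𝓘(𝕜, E) c x)] fun y =>
      (localRep x a ((extChartAt 𝓘(𝕜, E) x ∘ (extChartAt 𝓘(𝕜, E) c).symm) y)).comp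
        (fderiv 𝕜 (extChartAt 𝓘(𝕜, E) x ∘ (extChartAt 𝓘(𝕜, E) c).symm) y) := by
  have hy₀ := (extChartAt 𝓘(𝕜, E) c).map_source hx
  have htgt : (extChartAt 𝓘(𝕜, E) c).target ∈ 𝓝 (extChartAt 𝓘(𝕜, E) c x) :=
    (isOpen_extChartAt_target c).mem_nhds hy₀
  have hsrc : ∀ᶠ y in 𝓝 (extChartAt 𝓘(𝕜, E) c x),
      (extChartAt 𝓘(𝕜, E) c).symm y ∈ (extChartAt 𝓘(𝕜, E) x).source := by
    refine (continuousAt_extChartAt_symm'' hy₀).eventually_mem ?_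
    rw [(extChartAt 𝓘(𝕜, E) c).left_inv hx]
    exact extChartAt_source_mem_nhds x
  filter_upwards [htgt, hsrc, hsrc.eventually_nhds] with y hy hys hyn
  have hτ : DifferentiableAt 𝕜 (extChartAt 𝓘(𝕜, E) x ∘ (extChartAt 𝓘(𝕜, E) c).symm) y := by
    have := contDiffAt_coordChange (n := 1) (𝕜 := 𝕜)
      ((extChartAt 𝓘(𝕜, E) c).map_target hy) hys
    rw [(extChartAt 𝓘(𝕜, E) c).right_inv hy] at this
    exact this.differentiableAt one_ne_zero
  have heq : (extChartAt 𝓘(𝕜, E) c).symm =ᶠ[𝓝 y] (extChartAt 𝓘(𝕜, E) x).symm ∘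
      (extChartAt 𝓘(𝕜, E) x ∘ (extChartAt 𝓘(𝕜, E) c).symm) := by
    filter_upwards [hyn] with z hz
    simp only [Function.comp_apply]
    exact ((extChartAt 𝓘(𝕜, E) x).left_inv hz).symm
  have hpt := heq.self_of_nhds
  have hder : HasMFDerivAt 𝓘(𝕜, E) 𝓘(𝕜, E) (extChartAt 𝓘(𝕜, E) c).symm y
      ((mfderiv 𝓘(𝕜, E) 𝓘(𝕜, E) (extChartAt 𝓘(𝕜, E) x).symm
          ((extChartAt 𝓘(𝕜, E) x ∘ (extChartAt 𝓘(𝕜, E) c).symm) y)).comp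
        (fderiv 𝕜 (extChartAt 𝓘(𝕜, E) x ∘ (extChartAt 𝓘(𝕜, E) c).symm) y)) :=
    (HasMFDerivAt.comp y (mdifferentiableAt_extChartAt_symm_of_mem
      ((extChartAt 𝓘(𝕜, E) x).map_source hys)).hasMFDerivAt
        hτ.hasFDerivAt.hasMFDerivAt).congr_of_eventuallyEq heq
  have hmf : localRep c a y = ContinuousLinearMap.comp
      (show E →L[𝕜] F from a ((extChartAt 𝓘(𝕜, E) c).symm y)) _ :=
    congrArg (ContinuousLinearMap.comp
      (show E →L[𝕜] F from a ((extChartAt 𝓘(𝕜, E) c).symm y))) hder.mfderiv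
  -- All tangent spaces are the model space `E`, so the base point can be replaced by an equal one
  -- without transport.
  exact hmf.trans (congrArg (fun p : M => ContinuousLinearMap.comp (show E →L[𝕜] F from a p)
    (ContinuousLinearMap.comp (show E →L[𝕜] E from (mfderiv 𝓘(𝕜, E) 𝓘(𝕜, E)
      (extChartAt 𝓘(𝕜, E) x).symm ((extChartAt 𝓘(𝕜, E) x ∘ (extChartAt 𝓘(𝕜, E) c).symm) y)))
    (fderiv 𝕜 (extChartAt 𝓘(𝕜, E) x ∘ (extChartAt 𝓘(𝕜, E) c).symm) y))) hpt)

end LocalRep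

/-! ### Closed one-forms and their primitives. -/

section Primitive

variable {E : Type*} [NormedAddCommGroup E] [NormedSpace ℝ E]
  {M : Type*} [TopologicalSpace M] [ChartedSpace E M]

theorem contDiffAt_localRep [IsManifold 𝓘(ℝ, E) ∞ M] {F : Type*} [NormedAddCommGroup F]
    [NormedSpace ℝ F] {c x : M} {a : (x : M) → TangentSpace 𝓘(ℝ, E) x →L[ℝ] F}
    (hx : x ∈ (extChartAt 𝓘(ℝ, E) c).source)
    (ha : ContDiffAt ℝ ∞ (localRep x a) (extChartAt 𝓘(ℝ, E) x x)) :
    ContDiffAt ℝ ∞ (localRep c a) (extChartAt 𝓘(ℝ, E) c x) := by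
  have : IsManifold 𝓘(ℝ, E) 1 M := IsManifold.of_le (n := ∞) (by norm_cast)
  refine ContDiffAt.congr_of_eventuallyEq ?_ (localRep_eventuallyEq c a hx)
  have hτ := contDiffAt_coordChange (𝕜 := ℝ) (n := ∞) hx (mem_extChartAt_source (I := 𝓘(ℝ, E)) x)
  refine ContDiffAt.clm_comp (ContDiffAt.comp (g := localRep x a) _ ?_ hτ)
    (hτ.fderiv_right (m := ∞) (by simp))
  rwa [Function.comp_apply, (extChartAt 𝓘(ℝ, E) c).left_inv hx]

/-- `extD` at `x` uses the preferred chart at `x`, a chart that varies with the point, whereas the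
Poincaré lemma needs one fixed chart. Naturality of the exterior derivative under the coordinate
change carries closedness to the chart at `c`, where it says that the derivative is symmetric. -/
theorem fderiv_localRep_symm [IsManifold 𝓘(ℝ, E) ∞ M] {F : Type*} [NormedAddCommGroup F]
    [NormedSpace ℝ F] {c x : M} {a : (x : M) → TangentSpace 𝓘(ℝ, E) x →L[ℝ] F}
    (hx : x ∈ (extChartAt 𝓘(ℝ, E) c).source)
    (ha : ContDiffAt ℝ ∞ (localRep x a) (extChartAt 𝓘(ℝ, E) x x))
    (hcl : extD 𝓘(ℝ, E) (oneForm 𝓘(ℝ, E) a) x = 0) (v w : E) :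
    fderiv ℝ (localRep c a) (extChartAt 𝓘(ℝ, E) c x) v w
      = fderiv ℝ (localRep c a) (extChartAt 𝓘(ℝ, E) c x) w v := by
  have : IsManifold 𝓘(ℝ, E) 1 M := IsManifold.of_le (n := ∞) (by norm_cast)
  have hτ := contDiffAt_coordChange (𝕜 := ℝ) (n := ∞) hx (mem_extChartAt_source (I := 𝓘(ℝ, E)) x)
  have hc := (contDiffAt_localRep hx ha).differentiableAt (by simp)
  have hpt : (extChartAt 𝓘(ℝ, E) x ∘ (extChartAt 𝓘(ℝ, E) c).symm) (extChartAt 𝓘(ℝ, E) c x)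
      = extChartAt 𝓘(ℝ, E) x x := by
    rw [Function.comp_apply, (extChartAt 𝓘(ℝ, E) c).left_inv hx]
  rw [← sub_eq_zero, ← extDeriv_ofSubsingleton_apply hc]
  have heq : (fun z => ContinuousAlternatingMap.ofSubsingleton ℝ E F (0 : Fin 1) (localRep c a z))
      =ᶠ[𝓝 (extChartAt 𝓘(ℝ, E) c x)] fun y =>
      (ContinuousAlternatingMap.ofSubsingleton ℝ E F (0 : Fin 1) (localRep x a
        ((extChartAt 𝓘(ℝ, E) x ∘ (extChartAt 𝓘(ℝ, E) c).symm) y))).compContinuousLinearMap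
        (fderiv ℝ (extChartAt 𝓘(ℝ, E) x ∘ (extChartAt 𝓘(ℝ, E) c).symm) y) := by
    filter_upwards [localRep_eventuallyEq c a hx] with y hy
    rw [hy]
    rfl
  rw [heq.extDeriv_eq]
  have hω : DifferentiableAt ℝ
      (fun z => ContinuousAlternatingMap.ofSubsingleton ℝ E F (0 : Fin 1) (localRep x a z))
      ((extChartAt 𝓘(ℝ, E) x ∘ (extChartAt 𝓘(ℝ, E) c).symm) (extChartAt 𝓘(ℝ, E) c x)) := by
    rw [hpt]
    exact (ContinuousAlternatingMap.ofSubsingletonLIE (𝕜 := ℝ) (E := E) (F := F)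
      (0 : Fin 1)).differentiable.differentiableAt.comp _ (ha.differentiableAt (by simp))
  rw [extDeriv_pullback hω hτ (by simp [minSmoothness_of_isRCLikeNormedField]; norm_cast)]
  have h0 : extDeriv
      (fun z => ContinuousAlternatingMap.ofSubsingleton ℝ E F (0 : Fin 1) (localRep x a z))
      (extChartAt 𝓘(ℝ, E) x x) = 0 := hcl
  rw [hpt, h0]
  rfl

/-- In the chart at `x` the derivative vanishes on a ball, which is convex, so the mean value
inequality applies. -/
theorem eventually_eq_of_hasMFDerivAt_zero [IsManifold 𝓘(ℝ, E) 1 M] {h : M → ℝ} {x : M}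
    (hh : ∀ᶠ z in 𝓝 x, HasMFDerivAt 𝓘(ℝ, E) 𝓘(ℝ) h z
      (0 : TangentSpace 𝓘(ℝ, E) z →L[ℝ] ℝ)) :
    ∀ᶠ y in 𝓝 x, h y = h x := by
  obtain ⟨r, hr, hball⟩ := Metric.mem_nhds_iff.1
    (Filter.inter_mem (extChartAt_target_mem_nhds (I := 𝓘(ℝ, E)) x)
      (extChartAt_preimage_mem_nhds (I := 𝓘(ℝ, E)) hh))
  have hg : ∀ y ∈ Metric.ball (extChartAt 𝓘(ℝ, E) x x) r,
      HasFDerivAt (h ∘ (extChartAt 𝓘(ℝ, E) x).symm) (0 : E →L[ℝ] ℝ) y := by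
    intro y hy
    have h1 : HasFDerivAt (h ∘ (extChartAt 𝓘(ℝ, E) x).symm) ((0 : E →L[ℝ] ℝ).comp
        (show E →L[ℝ] E from mfderiv 𝓘(ℝ, E) 𝓘(ℝ, E) (extChartAt 𝓘(ℝ, E) x).symm y)) y :=
      (HasMFDerivAt.comp y (hball hy).2
        (mdifferentiableAt_extChartAt_symm_of_mem (hball hy).1).hasMFDerivAt).hasFDerivAt
    rwa [ContinuousLinearMap.zero_comp] at h1
  have hconst := fun y hy => (convex_ball (extChartAt 𝓘(ℝ, E) x x)
    r).is_const_of_fderivWithin_eq_zero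
    (𝕜 := ℝ) (f := h ∘ (extChartAt 𝓘(ℝ, E) x).symm)
    (fun y hy => (hg y hy).differentiableAt.differentiableWithinAt)
    (fun y hy => by
      rw [fderivWithin_of_isOpen Metric.isOpen_ball hy, (hg y hy).fderiv])
    (x := y) hy (Metric.mem_ball_self hr)
  have hsrc := extChartAt_source_mem_nhds (I := 𝓘(ℝ, E)) x
  filter_upwards [hsrc, (continuousAt_extChartAt (I := 𝓘(ℝ, E)) x).eventually_mem
    (Metric.ball_mem_nhds _ hr)] with y hys hy
  have h2 := hconst _ hy
  rwa [Function.comp_apply, Function.comp_apply, (extChartAt 𝓘(ℝ, E) x).left_inv hys,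
    extChartAt_to_inv] at h2

/-- Closed one-forms on simply connected open sets are exact. -/
theorem exists_primitive [IsManifold 𝓘(ℝ, E) ∞ M] {U : Set M} (hU : IsOpen U)
    [SimplyConnectedSpace U] {a : (x : M) → TangentSpace 𝓘(ℝ, E) x →L[ℝ] ℝ}
    (ha : ∀ x ∈ U, ContDiffAt ℝ ∞ (localRep x a) (extChartAt 𝓘(ℝ, E) x x))
    (hcl : ∀ x ∈ U, extD 𝓘(ℝ, E) (oneForm 𝓘(ℝ, E) a) x = 0) :
    ∃ K : M → ℝ, ContMDiffOn 𝓘(ℝ, E) 𝓘(ℝ) ∞ K U ∧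
      ∀ x ∈ U, HasMFDerivAt 𝓘(ℝ, E) 𝓘(ℝ) K x (a x) := by
  have : IsManifold 𝓘(ℝ, E) 1 M := IsManifold.of_le (n := ∞) (by norm_cast)
  have : LocallyPathConnectedSpace M := ChartedSpace.locallyPathConnectedSpace E M
  have : LocallyPathConnectedSpace U := hU.locallyPathConnectedSpace
  -- Poincaré lemma: a ball in the chart at each point carries a primitive.
  have hloc : ∀ x : U, ∃ (B : Set M) (f : M → ℝ), IsOpen B ∧ (x : M) ∈ B ∧ B ⊆ U ∧
      ∀ z ∈ B, ContMDiffAt 𝓘(ℝ, E) 𝓘(ℝ) ∞ f z ∧ HasMFDerivAt 𝓘(ℝ, E) 𝓘(ℝ) f z (a z) := by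
    rintro ⟨c, hcU⟩
    obtain ⟨r, hr, hball⟩ : ∃ r > 0, Metric.ball (extChartAt 𝓘(ℝ, E) c c) r ⊆
        (extChartAt 𝓘(ℝ, E) c).target ∩ (extChartAt 𝓘(ℝ, E) c).symm ⁻¹' U := by
      refine Metric.mem_nhds_iff.1 (Filter.inter_mem (extChartAt_target_mem_nhds c) ?_)
      exact extChartAt_preimage_mem_nhds (hU.mem_nhds hcU)
    have hsm : ∀ y ∈ Metric.ball (extChartAt 𝓘(ℝ, E) c c) r, ContDiffAt ℝ ∞ (localRep c a) y := by
      intro y hy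
      have h := contDiffAt_localRep ((extChartAt 𝓘(ℝ, E) c).map_target (hball hy).1)
        (ha _ (hball hy).2)
      rwa [(extChartAt 𝓘(ℝ, E) c).right_inv (hball hy).1] at h
    have hdiff : DifferentiableOn ℝ (localRep c a) (Metric.ball (extChartAt 𝓘(ℝ, E) c c) r) :=
      fun y hy => ((hsm y hy).differentiableAt (by simp)).differentiableWithinAt
    obtain ⟨g, hg⟩ := (convex_ball (extChartAt 𝓘(ℝ, E) c c)
      r).exists_forall_hasFDerivAt_of_fderiv_symmetric
      Metric.isOpen_ball hdiff (by
        intro y hy v w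
        have h := fderiv_localRep_symm ((extChartAt 𝓘(ℝ, E) c).map_target (hball hy).1)
          (ha _ (hball hy).2) (hcl _ (hball hy).2) v w
        rwa [(extChartAt 𝓘(ℝ, E) c).right_inv (hball hy).1] at h)
    -- The primitive is smooth because its derivative is the smooth coordinate expression of `a`.
    have hgs : ContDiffOn ℝ ∞ g (Metric.ball (extChartAt 𝓘(ℝ, E) c c) r) := by
      rw [contDiffOn_infty_iff_fderiv_of_isOpen Metric.isOpen_ball]
      refine ⟨fun y hy => (hg y hy).differentiableAt.differentiableWithinAt, fun y hy => ?_⟩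
      exact (hsm y hy).contDiffWithinAt.congr (fun z hz => (hg z hz).fderiv) (hg y hy).fderiv
    refine ⟨(extChartAt 𝓘(ℝ, E) c).source ∩ extChartAt 𝓘(ℝ, E) c ⁻¹'
      Metric.ball (extChartAt 𝓘(ℝ, E) c c) r, g ∘ extChartAt 𝓘(ℝ, E) c,
      isOpen_extChartAt_preimage' c Metric.isOpen_ball,
      ⟨mem_extChartAt_source c, Metric.mem_ball_self hr⟩, ?_, ?_⟩
    · rintro z ⟨hz, hzb⟩
      have h := (hball hzb).2
      rwa [Set.mem_preimage, (extChartAt 𝓘(ℝ, E) c).left_inv hz] at h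
    · rintro z ⟨hz, hzb⟩
      have hz' : z ∈ (chartAt E c).source := by simpa using hz
      constructor
      · exact ContMDiffAt.comp z (hgs.contDiffAt (Metric.isOpen_ball.mem_nhds hzb)).contMDiffAt
          (contMDiffAt_extChartAt' hz')
      · have h1 := (hg _ hzb).hasMFDerivAt.comp z
          (mdifferentiableAt_extChartAt (I := 𝓘(ℝ, E)) hz').hasMFDerivAt
        have hinv := mfderivWithin_extChartAt_symm_comp_mfderiv_extChartAt' (I := 𝓘(ℝ, E)) hz
        rw [ModelWithCorners.range_eq_univ, mfderivWithin_univ] at hinv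
        -- Going through the chart and back has differential the identity, so `a` is recovered from
        -- its coordinate expression.
        have h2 : a z = (localRep c a (extChartAt 𝓘(ℝ, E) c z)).comp
            (mfderiv 𝓘(ℝ, E) 𝓘(ℝ, E) (extChartAt 𝓘(ℝ, E) c) z) := by
          refine ContinuousLinearMap.ext fun v => ?_
          refine Eq.trans ?_ (congrArg (show E →L[ℝ] ℝ from
            a ((extChartAt 𝓘(ℝ, E) c).symm (extChartAt 𝓘(ℝ, E) c z)))
            (DFunLike.congr_fun hinv v).symm)
          exact congrArg (fun p : M => (show E →L[ℝ] ℝ from a p) v)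
            ((extChartAt 𝓘(ℝ, E) c).left_inv hz).symm
        rw [h2]
        exact h1
  choose B f hB hmem hBU hf using hloc
  have hmap : ∀ x : U, Filter.map ((↑) : U → M) (𝓝 x) = 𝓝 (x : M) :=
    fun x => hU.isOpenEmbedding_subtypeVal.map_nhds_eq x
  obtain ⟨K, hK⟩ := exists_of_locally_sub_eventually_const (X := U)
    (fun x => Subtype.val ⁻¹' B x) (fun x y => f x y) (fun x => (hB x).preimage continuous_subtype_val)
    hmem (by
      rintro i j x ⟨hi, hj⟩
      -- On overlaps two local primitives have the same differential, hence differ by a local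
      -- constant.
      have h : ∀ᶠ z in 𝓝 (x : M), HasMFDerivAt 𝓘(ℝ, E) 𝓘(ℝ) (f i - f j) z
          (0 : TangentSpace 𝓘(ℝ, E) z →L[ℝ] ℝ) := by
        filter_upwards [(hB i).mem_nhds hi, (hB j).mem_nhds hj] with z hzi hzj
        have h1 := (hf i z hzi).2.sub (hf j z hzj).2
        rwa [sub_self] at h1
      exact continuous_subtype_val.continuousAt.eventually (eventually_eq_of_hasMFDerivAt_zero h))
  classical
  -- The value `0` off `U` is immaterial: `U` is open, so germs at its points do not see it.
  let K' : M → ℝ := fun x => if h : x ∈ U then K ⟨x, h⟩ else 0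
  have hK' : ∀ x (hx : x ∈ U), ∀ᶠ y in 𝓝 x, K' y = f ⟨x, hx⟩ y + (K ⟨x, hx⟩ - f ⟨x, hx⟩ x) := by
    intro x hx
    rw [← hmap ⟨x, hx⟩, Filter.eventually_map]
    filter_upwards [hK ⟨x, hx⟩] with y hy
    simp only [K', y.2, dif_pos]
    linarith
  refine ⟨K', fun x hx => ?_, fun x hx => ?_⟩
  · refine ContMDiffAt.contMDiffWithinAt (ContMDiffAt.congr_of_eventuallyEq ?_ (hK' x hx))
    exact (hf ⟨x, hx⟩ x (hmem _)).1.add contMDiffAt_const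
  · refine HasMFDerivAt.congr_of_eventuallyEq ?_ (hK' x hx)
    have h1 := (hf ⟨x, hx⟩ x (hmem _)).2.add
      (hasMFDerivAt_const (I := 𝓘(ℝ, E)) (I' := 𝓘(ℝ)) (K ⟨x, hx⟩ - f ⟨x, hx⟩ x) x)
    have h2 : a x = a x + 0 := (add_zero (M := E →L[ℝ] ℝ) (a x)).symm
    rw [h2]
    exact h1

end Primitive

/-! ### Complex manifolds as real manifolds. -/

section RestrictScalars

theorem isManifold_real {E : Type*} [NormedAddCommGroup E] [NormedSpace ℂ E]
    (M : Type*) [TopologicalSpace M] [ChartedSpace E M] {n : WithTop ℕ∞}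
    [IsManifold 𝓘(ℂ, E) n M] : IsManifold 𝓘(ℝ, E) n M := by
  refine isManifold_of_contDiffOn 𝓘(ℝ, E) n M fun e e' he he' => ?_
  have h := (contDiffGroupoid n 𝓘(ℂ, E)).compatible he he'
  exact ((contDiffGroupoid n 𝓘(ℂ, E)).mem_of_eqOnSource h (Setoid.refl _)).1.restrict_scalars ℝ

variable {E : Type*} [NormedAddCommGroup E] [NormedSpace ℂ E] {H : Type*} [TopologicalSpace H]
  {I : ModelWithCorners ℂ E H} {J : ModelWithCorners ℝ E H}
  {M : Type*} [TopologicalSpace M] [ChartedSpace H M]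
  {E' : Type*} [NormedAddCommGroup E'] [NormedSpace ℂ E'] {H' : Type*} [TopologicalSpace H']
  {I' : ModelWithCorners ℂ E' H'} {J' : ModelWithCorners ℝ E' H'}
  {M' : Type*} [TopologicalSpace M'] [ChartedSpace H' M']

theorem extChartAt_congr_model (hIJ : I.toPartialEquiv = J.toPartialEquiv) (x : M) :
    extChartAt I x = extChartAt J x := by
  simp only [extChartAt, OpenPartialHomeomorph.extend, hIJ]

/-- Extended charts depend on a model only through its underlying partial equivalence, so the two
derivatives concern the same function in coordinates. For the models used here the equalities hold
by `rfl`. -/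
theorem hasMFDerivAt_restrictScalars (hIJ : I.toPartialEquiv = J.toPartialEquiv)
    (hIJ' : I'.toPartialEquiv = J'.toPartialEquiv) {f : M → M'} {x : M}
    {f' : E →L[ℂ] E'} (h : HasMFDerivAt I I' f x f') :
    HasMFDerivAt J J' f x (f'.restrictScalars ℝ) := by
  have hr : Set.range I = Set.range J := congrArg (fun e : PartialEquiv H E => Set.range e) hIJ
  refine ⟨h.1, ?_⟩
  have h2 := h.2
  simp only [writtenInExtChartAt, extChartAt_congr_model hIJ, extChartAt_congr_model hIJ', hr] at h2
  exact HasFDerivWithinAt.restrictScalars ℝ h2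

end RestrictScalars

theorem hasFDerivAt_apply_comp {𝕜 V G W F : Type*} [NontriviallyNormedField 𝕜]
    [NormedAddCommGroup V] [NormedSpace 𝕜 V] [NormedAddCommGroup G] [NormedSpace 𝕜 G]
    [NormedAddCommGroup W] [NormedSpace 𝕜 W] [NormedAddCommGroup F] [NormedSpace 𝕜 F]
    (S : V →L[𝕜] W →L[𝕜] F) (T : G →L[𝕜] W) (y : V) :
    HasFDerivAt (fun y => (S y).comp T) (((ContinuousLinearMap.compL 𝕜 G W F).flip T).comp S) y :=
  (((ContinuousLinearMap.compL 𝕜 G W F).flip T).comp S).hasFDerivAt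

/-! ### Canonical coordinates on the holomorphic cotangent bundle. -/

section Cotangent

variable {E : Type*} [NormedAddCommGroup E] [NormedSpace ℂ E]
  {L : Type*} [TopologicalSpace L] [ChartedSpace E L] [IsManifold 𝓘(ℂ, E) ω L]

/-- A hom-bundle trivialization precomposes with the inverse of the tangent trivialization, which is
the differential of the inverse chart; the trivial target contributes the identity. -/
theorem trivializationAt_cotangent (c : L) {z : L} (hz : z ∈ (chartAt E c).source)
    (α : TangentSpace 𝓘(ℂ, E) z →L[ℂ] ℂ) :
    trivializationAt (E →L[ℂ] ℂ) (fun x : L => TangentSpace 𝓘(ℂ, E) x →L[ℂ] Trivial L ℂ x) c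
        (⟨z, α⟩ : Cotangent E L)
      = (z, (α : E →L[ℂ] ℂ).comp (mfderiv 𝓘(ℂ, E) 𝓘(ℂ, E) (extChartAt 𝓘(ℂ, E) c).symm
          (extChartAt 𝓘(ℂ, E) c z))) := by
  have : IsManifold 𝓘(ℂ, E) 1 L := IsManifold.of_le (n := ω) le_top
  have h := TangentBundle.symmL_trivializationAt (I := 𝓘(ℂ, E)) hz
  rw [ModelWithCorners.range_eq_univ, mfderivWithin_univ] at h
  rw [hom_trivializationAt_apply]
  refine Prod.ext rfl ?_
  simp only [ContinuousLinearMap.inCoordinates]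
  refine ContinuousLinearMap.ext fun v => ?_
  simp only [ContinuousLinearMap.comp_apply]
  rw [h]
  simp
  rfl

theorem extChartAt_cotangent (p : Cotangent E L) {z : L} (hz : z ∈ (chartAt E p.proj).source)
    (α : TangentSpace 𝓘(ℂ, E) z →L[ℂ] ℂ) :
    extChartAt (𝓘(ℂ, E).prod 𝓘(ℂ, E →L[ℂ] ℂ)) p (⟨z, α⟩ : Cotangent E L)
      = (extChartAt 𝓘(ℂ, E) p.proj z,
        (α : E →L[ℂ] ℂ).comp (mfderiv 𝓘(ℂ, E) 𝓘(ℂ, E) (extChartAt 𝓘(ℂ, E) p.proj).symm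
          (extChartAt 𝓘(ℂ, E) p.proj z))) := by
  rw [FiberBundle.extChartAt]
  simp only [PartialEquiv.trans_apply]
  have h := trivializationAt_cotangent p.proj hz α
  exact congrArg (fun q : L × (E →L[ℂ] ℂ) => (extChartAt 𝓘(ℂ, E) p.proj q.1, q.2)) h

instance : IsManifold (𝓘(ℂ, E).prod 𝓘(ℂ, E →L[ℂ] ℂ)) 1 (Cotangent E L) := by
  have : IsManifold 𝓘(ℂ, E) (1 + 1) L := IsManifold.of_le (n := ω) le_top
  have : IsManifold 𝓘(ℂ, E) 1 L := IsManifold.of_le (n := ω) le_top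
  infer_instance


theorem mdifferentiableAt_extChartAt_cotangent_symm {p : Cotangent E L} {y : E × (E →L[ℂ] ℂ)}
    (hy : y ∈ (extChartAt (𝓘(ℂ, E).prod 𝓘(ℂ, E →L[ℂ] ℂ)) p).target) :
    MDifferentiableAt 𝓘(ℂ, E × (E →L[ℂ] ℂ)) (𝓘(ℂ, E).prod 𝓘(ℂ, E →L[ℂ] ℂ))
      (extChartAt (𝓘(ℂ, E).prod 𝓘(ℂ, E →L[ℂ] ℂ)) p).symm y := by
  have := mdifferentiableWithinAt_extChartAt_symm hy
  rwa [ModelWithCorners.range_eq_univ, mdifferentiableWithinAt_univ] at this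

theorem mem_extChartAt_cotangent_target (p : Cotangent E L) {y : E × (E →L[ℂ] ℂ)} :
    y ∈ (extChartAt (𝓘(ℂ, E).prod 𝓘(ℂ, E →L[ℂ] ℂ)) p).target ↔
      y.1 ∈ (extChartAt 𝓘(ℂ, E) p.proj).target := by
  rw [FiberBundle.extChartAt_target]
  constructor
  · exact fun h => h.1.1
  · intro h
    refine ⟨⟨h, ?_⟩, trivial⟩
    have h' := (extChartAt 𝓘(ℂ, E) p.proj).map_target h
    rw [extChartAt_source] at h'
    simpa using h'

theorem extChartAt_cotangent_symm_proj (p : Cotangent E L) {y : E × (E →L[ℂ] ℂ)}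
    (hy : y ∈ (extChartAt (𝓘(ℂ, E).prod 𝓘(ℂ, E →L[ℂ] ℂ)) p).target) :
    ((extChartAt (𝓘(ℂ, E).prod 𝓘(ℂ, E →L[ℂ] ℂ)) p).symm y).proj
      = (extChartAt 𝓘(ℂ, E) p.proj).symm y.1 := by
  rw [FiberBundle.extChartAt_target] at hy
  rw [FiberBundle.extChartAt]
  exact (trivializationAt (E →L[ℂ] ℂ)
    (fun x : L => TangentSpace 𝓘(ℂ, E) x →L[ℂ] Trivial L ℂ x) p.proj).proj_symm_apply' hy.1.2

/-- In the canonical coordinates `(q, p)` of the cotangent bundle, the tautological form is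
`p dq`. -/
theorem chartForm_tautologicalForm (p : Cotangent E L) {y : E × (E →L[ℂ] ℂ)}
    (hy : y ∈ (extChartAt (𝓘(ℂ, E).prod 𝓘(ℂ, E →L[ℂ] ℂ)) p).target) :
    chartForm (𝓘(ℂ, E).prod 𝓘(ℂ, E →L[ℂ] ℂ)) p (tautologicalForm E L) y
      = ContinuousAlternatingMap.ofSubsingleton ℂ (E × (E →L[ℂ] ℂ)) ℂ (0 : Fin 1)
          (y.2.comp (ContinuousLinearMap.fst ℂ E (E →L[ℂ] ℂ))) := by
  have : IsManifold 𝓘(ℂ, E) 1 L := IsManifold.of_le (n := ω) le_top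
  set e := extChartAt (𝓘(ℂ, E).prod 𝓘(ℂ, E →L[ℂ] ℂ)) p with he
  have hy₁ := (mem_extChartAt_cotangent_target p).1 hy
  have hproj := extChartAt_cotangent_symm_proj p hy
  have hsrc : (e.symm y).proj ∈ (chartAt E p.proj).source := by
    rw [hproj, ← extChartAt_source 𝓘(ℂ, E)]
    exact (extChartAt 𝓘(ℂ, E) p.proj).map_target hy₁
  -- Writing `y` as the coordinates of its own preimage identifies `y.2` with that covector composed
  -- with the differential of the inverse base chart.
  have hcoord : y = _ := (e.right_inv hy).symm.trans (extChartAt_cotangent p hsrc (e.symm y).2)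
  have hy2 := congrArg Prod.snd hcoord
  have hy1 := congrArg Prod.fst hcoord
  have hcomp : HasMFDerivAt 𝓘(ℂ, E × (E →L[ℂ] ℂ)) 𝓘(ℂ, E)
      ((fun q : Cotangent E L => q.proj) ∘ e.symm) y
      ((mfderiv (𝓘(ℂ, E).prod 𝓘(ℂ, E →L[ℂ] ℂ)) 𝓘(ℂ, E) (fun q : Cotangent E L => q.proj)
        (e.symm y)).comp
        (mfderiv 𝓘(ℂ, E × (E →L[ℂ] ℂ)) (𝓘(ℂ, E).prod 𝓘(ℂ, E →L[ℂ] ℂ)) e.symm y)) :=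
    HasMFDerivAt.comp y
      ((Bundle.contMDiff_proj (n := 1) (IB := 𝓘(ℂ, E)) (F := E →L[ℂ] ℂ)
        (fun x : L => TangentSpace 𝓘(ℂ, E) x →L[ℂ] Trivial L ℂ x)).mdifferentiableAt
          one_ne_zero).hasMFDerivAt
      (mdifferentiableAt_extChartAt_cotangent_symm hy).hasMFDerivAt
  have heq : ((fun q : Cotangent E L => q.proj) ∘ e.symm) =ᶠ[𝓝 y]
      (extChartAt 𝓘(ℂ, E) p.proj).symm ∘ Prod.fst := by
    filter_upwards [(isOpen_extChartAt_target p).mem_nhds hy] with z hz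
    exact extChartAt_cotangent_symm_proj p hz
  have hcomp' : HasMFDerivAt 𝓘(ℂ, E × (E →L[ℂ] ℂ)) 𝓘(ℂ, E)
      ((fun q : Cotangent E L => q.proj) ∘ e.symm) y
      ((mfderiv 𝓘(ℂ, E) 𝓘(ℂ, E) (extChartAt 𝓘(ℂ, E) p.proj).symm y.1).comp
        (ContinuousLinearMap.fst ℂ E (E →L[ℂ] ℂ))) :=
    (HasMFDerivAt.comp y (mdifferentiableAt_extChartAt_symm_of_mem hy₁).hasMFDerivAt
      (hasFDerivAt_fst (𝕜 := ℂ) (p := y)).hasMFDerivAt).congr_of_eventuallyEq heq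
  -- The differential of `pr ∘ e.symm` computed in two ways: by the chain rule, and from its
  -- coordinate form, the inverse base chart after the first projection.
  have hder := hasMFDerivAt_unique hcomp hcomp'
  refine ContinuousAlternatingMap.ext fun v => ?_
  have h1 := congrArg (fun T : (E × (E →L[ℂ] ℂ)) →L[ℂ] E =>
    (show E →L[ℂ] ℂ from (e.symm y).2) (T (v 0))) hder
  refine Eq.trans h1 ?_
  have h2 := DFunLike.congr_fun hy2 (v 0).1
  refine Eq.trans ?_ h2.symm
  exact congrArg (fun z : E => (show E →L[ℂ] ℂ from (e.symm y).2)
    ((mfderiv 𝓘(ℂ, E) 𝓘(ℂ, E) (extChartAt 𝓘(ℂ, E) p.proj).symm z) (v 0).1)) hy1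

/-- In the preferred chart the tautological form is `p dq`, which is linear in the coordinates and
so is its own derivative; antisymmetrizing gives `dp ∧ dq`. -/
theorem canonicalForm_apply (p : Cotangent E L) (v w : E × (E →L[ℂ] ℂ)) :
    (show (E × (E →L[ℂ] ℂ)) [⋀^Fin 2]→L[ℂ] ℂ from canonicalForm E L p) ![v, w]
      = v.2 w.1 - w.2 v.1 := by
  have heq : chartForm (𝓘(ℂ, E).prod 𝓘(ℂ, E →L[ℂ] ℂ)) p (tautologicalForm E L)
      =ᶠ[𝓝 (extChartAt (𝓘(ℂ, E).prod 𝓘(ℂ, E →L[ℂ] ℂ)) p p)] fun y =>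
        ContinuousAlternatingMap.ofSubsingleton ℂ (E × (E →L[ℂ] ℂ)) ℂ (0 : Fin 1)
          (y.2.comp (ContinuousLinearMap.fst ℂ E (E →L[ℂ] ℂ))) := by
    filter_upwards [(isOpen_extChartAt_target p).mem_nhds (mem_extChartAt_target p)] with z hz
    exact chartForm_tautologicalForm p hz
  have hlin := hasFDerivAt_apply_comp (ContinuousLinearMap.snd ℂ E (E →L[ℂ] ℂ))
    (ContinuousLinearMap.fst ℂ E (E →L[ℂ] ℂ))
    (extChartAt (𝓘(ℂ, E).prod 𝓘(ℂ, E →L[ℂ] ℂ)) p p)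
  have h := extDeriv_ofSubsingleton_apply hlin.differentiableAt v w
  rw [hlin.fderiv] at h
  refine Eq.trans (DFunLike.congr_fun heq.extDeriv_eq ![v, w]) (h.trans ?_)
  simp

end Cotangent

/-! ### Sections of the cotangent bundle and pullback of the symplectic form. -/

section Sections

variable {E : Type*} [NormedAddCommGroup E] [NormedSpace ℂ E]
  {L : Type*} [TopologicalSpace L] [ChartedSpace E L]

/-- A complex-linear map, as a real-linear map. -/
def realLinear {G : Type*} [NormedAddCommGroup G] [NormedSpace ℂ G] (f : E →L[ℂ] G) : E →L[ℝ] G :=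
  f.restrictScalars ℝ

/-- A `(1,0)`-form, as a field of real-linear functionals. -/
def realCovector (η : (x : L) → TangentSpace 𝓘(ℂ, E) x →L[ℂ] ℂ) (x : L) :
    TangentSpace 𝓘(ℝ, E) x →L[ℝ] ℂ :=
  realLinear (E := E) (G := ℂ) (η x)

variable [IsManifold 𝓘(ℂ, E) ω L]

theorem localRep_realCovector (η : (x : L) → TangentSpace 𝓘(ℂ, E) x →L[ℂ] ℂ) (c : L) {y : E}
    (hy : y ∈ (extChartAt 𝓘(ℂ, E) c).target) :
    localRep c (realCovector η) y = (localRep (𝕜 := ℂ) c η y).restrictScalars ℝ := by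
  have : IsManifold 𝓘(ℂ, E) 1 L := IsManifold.of_le (n := ω) le_top
  have h := hasMFDerivAt_restrictScalars (J := 𝓘(ℝ, E)) (J' := 𝓘(ℝ, E)) rfl rfl
    (mdifferentiableAt_extChartAt_symm_of_mem hy).hasMFDerivAt
  refine ContinuousLinearMap.ext fun v => ?_
  exact congrArg (fun T : E →L[ℝ] E =>
    (show E →L[ℂ] ℂ from η ((extChartAt 𝓘(ℂ, E) c).symm y)) (T v)) h.mfderiv

/-- The fibre coordinate of the cotangent bundle is the coordinate expression of a covector, so in
charts the section is the graph map of `localRep x η`. Its derivative is thus `(id, T)`, with `T`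
the derivative of that expression. -/
theorem writtenInExtChartAt_formSection (η : (x : L) → TangentSpace 𝓘(ℂ, E) x →L[ℂ] ℂ) (x : L)
    {y : E} (hy : y ∈ (extChartAt 𝓘(ℂ, E) x).target) :
    writtenInExtChartAt 𝓘(ℝ, E) (𝓘(ℝ, E).prod 𝓘(ℝ, E →L[ℂ] ℂ)) x (formSection η) y
      = (y, localRep (𝕜 := ℂ) x η y) := by
  have hsrc : (extChartAt 𝓘(ℂ, E) x).symm y ∈ (chartAt E (formSection η x).proj).source := by
    have := (extChartAt 𝓘(ℂ, E) x).map_target hy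
    rwa [extChartAt_source] at this
  refine (extChartAt_cotangent (formSection η x) hsrc (η _)).trans ?_
  have hinv : extChartAt 𝓘(ℂ, E) x ((extChartAt 𝓘(ℂ, E) x).symm y) = y :=
    (extChartAt 𝓘(ℂ, E) x).right_inv hy
  refine Prod.ext hinv ?_
  exact congrArg (fun z : E => ContinuousLinearMap.comp
    (show E →L[ℂ] ℂ from η ((extChartAt 𝓘(ℂ, E) x).symm y))
    (show E →L[ℂ] E from mfderiv 𝓘(ℂ, E) 𝓘(ℂ, E) (extChartAt 𝓘(ℂ, E) x).symm z)) hinv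

theorem writtenInExtChartAt_formSection_eventuallyEq
    (η : (x : L) → TangentSpace 𝓘(ℂ, E) x →L[ℂ] ℂ) (x : L) :
    writtenInExtChartAt 𝓘(ℝ, E) (𝓘(ℝ, E).prod 𝓘(ℝ, E →L[ℂ] ℂ)) x (formSection η)
      =ᶠ[𝓝 (extChartAt 𝓘(ℝ, E) x x)] fun y => (y, localRep (𝕜 := ℂ) x η y) := by
  filter_upwards [extChartAt_target_mem_nhds (I := 𝓘(ℂ, E)) x] with y hy
  exact writtenInExtChartAt_formSection η x hy

theorem contDiffAt_localRep_of_formSection {n : WithTop ℕ∞}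
    {η : (x : L) → TangentSpace 𝓘(ℂ, E) x →L[ℂ] ℂ} {x : L}
    (h : ContMDiffAt 𝓘(ℝ, E) (𝓘(ℝ, E).prod 𝓘(ℝ, E →L[ℂ] ℂ)) n (formSection η) x) :
    ContDiffAt ℝ n (localRep (𝕜 := ℂ) x η) (extChartAt 𝓘(ℝ, E) x x) := by
  have h2 := (contMDiffAt_iff.1 h).2
  rw [ModelWithCorners.range_eq_univ, contDiffWithinAt_univ] at h2
  exact (h2.congr_of_eventuallyEq (writtenInExtChartAt_formSection_eventuallyEq η x).symm).snd

theorem hasMFDerivAt_formSection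
    {η : (x : L) → TangentSpace 𝓘(ℂ, E) x →L[ℂ] ℂ} {x : L}
    (h : ContMDiffAt 𝓘(ℝ, E) (𝓘(ℝ, E).prod 𝓘(ℝ, E →L[ℂ] ℂ)) 1 (formSection η) x) :
    HasMFDerivAt 𝓘(ℝ, E) (𝓘(ℝ, E).prod 𝓘(ℝ, E →L[ℂ] ℂ)) (formSection η) x
      ((ContinuousLinearMap.id ℝ E).prod
        (fderiv ℝ (localRep (𝕜 := ℂ) x η) (extChartAt 𝓘(ℝ, E) x x))) := by
  refine ⟨h.continuousAt, ?_⟩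
  have hd : HasFDerivAt (writtenInExtChartAt 𝓘(ℝ, E) (𝓘(ℝ, E).prod 𝓘(ℝ, E →L[ℂ] ℂ)) x
      (formSection η)) ((ContinuousLinearMap.id ℝ E).prod
        (fderiv ℝ (localRep (𝕜 := ℂ) x η) (extChartAt 𝓘(ℝ, E) x x))) (extChartAt 𝓘(ℝ, E) x x) :=
    ((hasFDerivAt_id _).prodMk ((contDiffAt_localRep_of_formSection h).differentiableAt
      one_ne_zero).hasFDerivAt).congr_of_eventuallyEq
        (writtenInExtChartAt_formSection_eventuallyEq η x)
  exact hd.hasFDerivWithinAt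

theorem localRep_realCovector_eventuallyEq (η : (x : L) → TangentSpace 𝓘(ℂ, E) x →L[ℂ] ℂ)
    (x : L) :
    localRep x (realCovector η) =ᶠ[𝓝 (extChartAt 𝓘(ℝ, E) x x)]
      fun y => ContinuousLinearMap.restrictScalarsL ℂ E ℂ ℝ ℝ (localRep (𝕜 := ℂ) x η y) := by
  filter_upwards [extChartAt_target_mem_nhds (I := 𝓘(ℂ, E)) x] with y hy
  exact localRep_realCovector η x hy

theorem contDiffAt_localRep_realCovector {n : WithTop ℕ∞}
    {η : (x : L) → TangentSpace 𝓘(ℂ, E) x →L[ℂ] ℂ} {x : L}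
    (h : ContMDiffAt 𝓘(ℝ, E) (𝓘(ℝ, E).prod 𝓘(ℝ, E →L[ℂ] ℂ)) n (formSection η) x) :
    ContDiffAt ℝ n (localRep x (realCovector η)) (extChartAt 𝓘(ℝ, E) x x) :=
  ContDiffAt.congr_of_eventuallyEq
    ((ContinuousLinearMap.restrictScalarsL ℂ E ℂ ℝ ℝ).contDiff.contDiffAt.comp _
      (contDiffAt_localRep_of_formSection h)) (localRep_realCovector_eventuallyEq η x)

theorem extD_realCovector_apply
    {η : (x : L) → TangentSpace 𝓘(ℂ, E) x →L[ℂ] ℂ} {x : L}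
    (h : ContMDiffAt 𝓘(ℝ, E) (𝓘(ℝ, E).prod 𝓘(ℝ, E →L[ℂ] ℂ)) 1 (formSection η) x) (v w : E) :
    (show E [⋀^Fin 2]→L[ℝ] ℂ from extD 𝓘(ℝ, E) (oneForm 𝓘(ℝ, E) (realCovector η)) x) ![v, w]
      = fderiv ℝ (localRep (𝕜 := ℂ) x η) (extChartAt 𝓘(ℝ, E) x x) v w
        - fderiv ℝ (localRep (𝕜 := ℂ) x η) (extChartAt 𝓘(ℝ, E) x x) w v := by
  have hd := ((contDiffAt_localRep_of_formSection h).differentiableAt one_ne_zero).hasFDerivAt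
  have hd' := ((ContinuousLinearMap.restrictScalarsL ℂ E ℂ ℝ ℝ).hasFDerivAt.comp _
    hd).congr_of_eventuallyEq (localRep_realCovector_eventuallyEq η x)
  refine (extDeriv_ofSubsingleton_apply hd'.differentiableAt v w).trans ?_
  rw [hd'.fderiv]
  rfl

variable {E' : Type*} [NormedAddCommGroup E'] [NormedSpace ℂ E']
  {Z : Type*} [TopologicalSpace Z] [ChartedSpace E' Z]
  {Ω : DiffForm 𝓘(ℂ, E') Z ℂ 2} {φ : OpenPartialHomeomorph (Cotangent E L) Z}

theorem hasMFDerivAt_darboux_formSection (hφ : IsDarbouxChart Ω φ)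
    {η : (x : L) → TangentSpace 𝓘(ℂ, E) x →L[ℂ] ℂ} {x : L}
    (h : ContMDiffAt 𝓘(ℝ, E) (𝓘(ℝ, E).prod 𝓘(ℝ, E →L[ℂ] ℂ)) 1 (formSection η) x)
    (hx : formSection η x ∈ φ.source) :
    HasMFDerivAt 𝓘(ℝ, E) 𝓘(ℝ, E') (fun y => φ (formSection η y)) x
      ((realLinear (E := E × (E →L[ℂ] ℂ)) (G := E')
        (mfderiv (𝓘(ℂ, E).prod 𝓘(ℂ, E →L[ℂ] ℂ)) 𝓘(ℂ, E') φ (formSection η x))).comp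
        ((ContinuousLinearMap.id ℝ E).prod
          (fderiv ℝ (localRep (𝕜 := ℂ) x η) (extChartAt 𝓘(ℝ, E) x x)))) := by
  have hm := ((hφ.holomorphic.contMDiffAt (φ.open_source.mem_nhds hx)).mdifferentiableAt
    (by simp)).hasMFDerivAt
  exact HasMFDerivAt.comp x (hasMFDerivAt_restrictScalars
    (J := 𝓘(ℝ, E).prod 𝓘(ℝ, E →L[ℂ] ℂ)) (J' := 𝓘(ℝ, E')) rfl rfl hm) (hasMFDerivAt_formSection h)

/-- In a Darboux chart, the restriction of `Ω` to the graph of `η` is `dη`. -/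
theorem pullback_darboux_formSection (hφ : IsDarbouxChart Ω φ)
    {η : (x : L) → TangentSpace 𝓘(ℂ, E) x →L[ℂ] ℂ} {x : L}
    (h : ContMDiffAt 𝓘(ℝ, E) (𝓘(ℝ, E).prod 𝓘(ℝ, E →L[ℂ] ℂ)) 1 (formSection η) x)
    (hx : formSection η x ∈ φ.source) :
    pullback 𝓘(ℝ, E) 𝓘(ℝ, E') (fun y => φ (formSection η y)) (realForm Ω) x
      = extD 𝓘(ℝ, E) (oneForm 𝓘(ℝ, E) (realCovector η)) x := by
  set T := fderiv ℝ (localRep (𝕜 := ℂ) x η) (extChartAt 𝓘(ℝ, E) x x) with hT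
  refine ContinuousAlternatingMap.ext fun v => ?_
  have hv : v = ![v 0, v 1] := by
    funext i
    fin_cases i <;> rfl
  have h1 := (hasMFDerivAt_darboux_formSection hφ h hx).mfderiv
  have h2 : pullback 𝓘(ℝ, E) 𝓘(ℝ, E') (fun y => φ (formSection η y)) (realForm Ω) x v
      = (show (E × (E →L[ℂ] ℂ)) [⋀^Fin 2]→L[ℂ] ℂ from
          pullback (𝓘(ℂ, E).prod 𝓘(ℂ, E →L[ℂ] ℂ)) 𝓘(ℂ, E') φ Ω (formSection η x))
        ((((ContinuousLinearMap.id ℝ E).prod T : E →L[ℝ] E × (E →L[ℂ] ℂ))) ∘ v) :=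
    congrArg (fun S : E →L[ℝ] E' =>
      (show E' [⋀^Fin 2]→L[ℂ] ℂ from Ω (φ (formSection η x))) (S ∘ v)) h1
  refine h2.trans ?_
  -- After replacing `φ^*Ω` by `Ω₀`, the value on `(v, T v)` and `(w, T w)` is `T v w - T w v`,
  -- which is `dη (v, w)`.
  rw [hφ.symplectic _ hx]
  have h3 : (((ContinuousLinearMap.id ℝ E).prod T : E →L[ℝ] E × (E →L[ℂ] ℂ))) ∘ v
      = ![(v 0, T (v 0)), (v 1, T (v 1))] := by
    funext i
    fin_cases i <;> rfl
  rw [h3]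
  refine (canonicalForm_apply _ _ _).trans ?_
  refine Eq.trans (extD_realCovector_apply h (v 0) (v 1)).symm ?_
  exact congrArg (show E [⋀^Fin 2]→L[ℝ] ℂ from
    extD 𝓘(ℝ, E) (oneForm 𝓘(ℝ, E) (realCovector η)) x) hv.symm

end Sections

/-! ### Isotropy of maps into the brane. -/

section Isotropy

variable {E EX : Type*} [NormedAddCommGroup E] [NormedSpace ℂ E]
  [NormedAddCommGroup EX] [NormedSpace ℂ EX]
  {Z X : Type*} [TopologicalSpace Z] [ChartedSpace E Z] [TopologicalSpace X] [ChartedSpace EX X]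
  {EL : Type*} [NormedAddCommGroup EL] [NormedSpace ℂ EL]
  {L : Type*} [TopologicalSpace L] [ChartedSpace EL L]

/-- A differentiable map into a Lagrangian section is isotropic. -/
theorem im_pullback_eq_zero_of_mem_lagrangian {Ω : DiffForm 𝓘(ℂ, E) Z ℂ 2} {pr : Z → X}
    (hpr : ContMDiff 𝓘(ℂ, E) 𝓘(ℂ, EX) ω pr) {𝓛 : Set Z} (h𝓛 : IsLagrangianSection (EX := EX) Ω pr 𝓛)
    {g : L → Z} (hg𝓛 : ∀ y, g y ∈ 𝓛) {x : L} (hg : MDifferentiableAt 𝓘(ℝ, EL) 𝓘(ℝ, E) g x)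
    (v w : EL) :
    ((show EL [⋀^Fin 2]→L[ℝ] ℂ from pullback 𝓘(ℝ, EL) 𝓘(ℝ, E) g (realForm Ω) x) ![v, w]).im
      = 0 := by
  obtain ⟨s, hs, hsec, hrange, hlag⟩ := h𝓛
  have hgs : ∀ y, s (pr (g y)) = g y := by
    intro y
    have hy := hg𝓛 y
    rw [← hrange] at hy
    obtain ⟨z, hz⟩ := hy
    rw [← hz, hsec]
  have hprR := hasMFDerivAt_restrictScalars (J := 𝓘(ℝ, E)) (J' := 𝓘(ℝ, EX)) rfl rfl
    ((hpr.mdifferentiable (by simp)) (g x)).hasMFDerivAt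
  have hpg := (HasMFDerivAt.comp x hprR hg.hasMFDerivAt)
  have hsd := ((hs.mdifferentiable (by simp)) (pr (g x))).hasMFDerivAt
  have hcomp := (HasMFDerivAt.comp x hsd hpg).congr_of_eventuallyEq
    (Filter.Eventually.of_forall fun y => (hgs y).symm)
  set S : EX →L[ℝ] E := mfderiv 𝓘(ℝ, EX) 𝓘(ℝ, E) s (pr (g x)) with hS
  set G : EL →L[ℝ] EX := ContinuousLinearMap.comp (realLinear (E := E) (G := EX)
    (mfderiv 𝓘(ℂ, E) 𝓘(ℂ, EX) pr (g x))) (show EL →L[ℝ] E from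
      mfderiv 𝓘(ℝ, EL) 𝓘(ℝ, E) g x) with hG
  have hder : (show EL →L[ℝ] E from mfderiv 𝓘(ℝ, EL) 𝓘(ℝ, E) g x) = S.comp G := hcomp.mfderiv
  have hzero : (show E [⋀^Fin 2]→L[ℝ] ℝ from imForm Ω (s (pr (g x)))) ![S (G v), S (G w)] = 0 :=
    (hlag (pr (g x)) (S (G w))).1 ⟨G w, rfl⟩ (G v)
  have h1 : (show E [⋀^Fin 2]→L[ℝ] ℝ from imForm Ω (g x)) ![S (G v), S (G w)] = 0 :=
    (congrArg (fun z : Z => (show E [⋀^Fin 2]→L[ℝ] ℝ from imForm Ω z) ![S (G v), S (G w)])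
      (hgs x)).symm.trans hzero
  refine Eq.trans ?_ h1
  have hvec : (fun T : EL →L[ℝ] E => (T : EL → E) ∘ ![v, w]) (S.comp G) = ![S (G v), S (G w)] := by
    funext i
    fin_cases i <;> rfl
  rw [← hvec, ← hder]
  rfl

end Isotropy

/-! ### Exterior derivative and constant linear maps of the coefficients. -/

section RealPart

variable {E : Type*} [NormedAddCommGroup E] [NormedSpace ℝ E]
  {M : Type*} [TopologicalSpace M] [ChartedSpace E M]

theorem extD_oneForm_comp_apply {F G : Type*} [NormedAddCommGroup F] [NormedSpace ℝ F]
    [NormedAddCommGroup G] [NormedSpace ℝ G] (A : F →L[ℝ] G)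
    {b : (x : M) → TangentSpace 𝓘(ℝ, E) x →L[ℝ] F} {x : M}
    (hb : DifferentiableAt ℝ (localRep x b) (extChartAt 𝓘(ℝ, E) x x)) (v w : E) :
    (show E [⋀^Fin 2]→L[ℝ] G from extD 𝓘(ℝ, E) (oneForm 𝓘(ℝ, E) fun z => A.comp (b z)) x) ![v, w]
      = A ((show E [⋀^Fin 2]→L[ℝ] F from extD 𝓘(ℝ, E) (oneForm 𝓘(ℝ, E) b) x) ![v, w]) := by
  have hc : HasFDerivAt (localRep x fun z => A.comp (b z)) _ (extChartAt 𝓘(ℝ, E) x x) :=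
    (ContinuousLinearMap.compL ℝ E F G A).hasFDerivAt.comp _ hb.hasFDerivAt
  refine (extDeriv_ofSubsingleton_apply hc.differentiableAt v w).trans ?_
  refine Eq.trans ?_ (congrArg A (extDeriv_ofSubsingleton_apply hb v w)).symm
  rw [hc.fderiv, map_sub]
  rfl

end RealPart

/-! ### Type decomposition and the operators `∂` and `∂̄`. -/

section Dolbeault

variable {E : Type*} [NormedAddCommGroup E] [NormedSpace ℂ E]

theorem mulI_apply (v : E) : mulI E v = Complex.I • v := rfl

theorem part10_apply (a : E →L[ℝ] ℝ) (v : E) :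
    part10 a v = (1 / 2 : ℂ) * ((a v : ℂ) - Complex.I * (a (Complex.I • v) : ℂ)) := by
  simp [part10, StrongDual.extendRCLike_apply]

theorem part01_apply (a : E →L[ℝ] ℝ) (v : E) :
    part01 a v = (1 / 2 : ℂ) * ((a v : ℂ) + Complex.I * (a (Complex.I • v) : ℂ)) := by
  simp [part01, mulI_apply, mul_add]

/-- The real part of `part10 a v` is `a v / 2`. -/
theorem part10_injective : Function.Injective (part10 (E := E)) := by
  intro a b hab
  ext v
  have h := congrArg Complex.re (DFunLike.congr_fun hab v)
  rw [part10_apply, part10_apply] at h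
  simpa using h

/-- For `a = -2 Im ξ`, complex linearity gives `a (i v) = -2 Re (ξ v)`, so the `(1,0)`-part of `a`
is `-Im ξ + i Re ξ = i ξ`. This fixes the factor `-2` in the equation for `K`. -/
theorem neg_I_smul_part10 (ξ : E →L[ℂ] ℂ) :
    -Complex.I • part10 (((-2 : ℝ) • Complex.imCLM).comp (realLinear ξ)) = ξ := by
  ext v
  simp only [_root_.smul_apply, part10_apply]
  simp only [realLinear, ContinuousLinearMap.comp_apply, _root_.smul_apply,
    ContinuousLinearMap.coe_restrictScalars', map_smul, Complex.imCLM_apply, smul_eq_mul,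
    Complex.mul_im, Complex.I_re, Complex.I_im]
  apply Complex.ext <;> simp

/-- `part01` as a continuous linear map. -/
def part01L (E : Type*) [NormedAddCommGroup E] [NormedSpace ℂ E] :
    (E →L[ℝ] ℝ) →L[ℝ] E →L[ℝ] ℂ :=
  (1 / 2 : ℂ) • (ContinuousLinearMap.compL ℝ E ℝ ℂ Complex.ofRealCLM
    + Complex.I • ((ContinuousLinearMap.compL ℝ E E ℂ).flip (mulI E)).comp
      (ContinuousLinearMap.compL ℝ E ℝ ℂ Complex.ofRealCLM))

theorem part01L_apply (a : E →L[ℝ] ℝ) : part01L E a = part01 a := rfl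

/-- The map `a ↦ -i a^{1,0}` as a continuous linear map. -/
def negIPart10L (E : Type*) [NormedAddCommGroup E] [NormedSpace ℂ E] :
    (E →L[ℝ] ℝ) →L[ℝ] E →L[ℝ] ℂ :=
  (-Complex.I * (1 / 2) : ℂ) • (ContinuousLinearMap.compL ℝ E ℝ ℂ Complex.ofRealCLM
    - Complex.I • ((ContinuousLinearMap.compL ℝ E E ℂ).flip (mulI E)).comp
      (ContinuousLinearMap.compL ℝ E ℝ ℂ Complex.ofRealCLM))

theorem negIPart10L_apply (a : E →L[ℝ] ℝ) :
    negIPart10L E a = realLinear (-Complex.I • part10 a) := by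
  ext v
  have h : negIPart10L E a v = (-Complex.I * (1 / 2) : ℂ) *
    ((a v : ℂ) - Complex.I * (a (Complex.I • v) : ℂ)) := rfl
  rw [h]
  change _ = -Complex.I * part10 a v
  rw [part10_apply]
  ring

/-- A complex-linear `T` commutes with multiplication by `i`, so taking types commutes with
holomorphic changes of coordinates. -/
theorem part01_comp (a : E →L[ℝ] ℝ) (T : E →L[ℂ] E) :
    (part01 a).comp (realLinear T) = part01 (a.comp (realLinear T)) := by
  ext v
  simp only [ContinuousLinearMap.comp_apply, part01_apply]
  simp [realLinear]

theorem part10_comp (a : E →L[ℝ] ℝ) (T : E →L[ℂ] E) :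
    (part10 a).comp T = part10 (a.comp (realLinear T)) := by
  ext v
  simp only [ContinuousLinearMap.comp_apply, part10_apply]
  simp [realLinear]

variable {L : Type*} [TopologicalSpace L] [ChartedSpace E L] [IsManifold 𝓘(ℂ, E) ω L]

/-- The differential of a real function as a field of functionals. -/
def realDiff (K : L → ℝ) (x : L) : TangentSpace 𝓘(ℝ, E) x →L[ℝ] ℝ :=
  mfderiv 𝓘(ℝ, E) 𝓘(ℝ) K x

theorem mfderiv_extChartAt_symm_real {c : L} {y : E} (hy : y ∈ (extChartAt 𝓘(ℂ, E) c).target) :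
    (show E →L[ℝ] E from mfderiv 𝓘(ℝ, E) 𝓘(ℝ, E) (extChartAt 𝓘(ℝ, E) c).symm y)
      = realLinear (E := E) (G := E)
        (mfderiv 𝓘(ℂ, E) 𝓘(ℂ, E) (extChartAt 𝓘(ℂ, E) c).symm y) := by
  have : IsManifold 𝓘(ℂ, E) 1 L := IsManifold.of_le (n := ω) le_top
  exact (hasMFDerivAt_restrictScalars (J := 𝓘(ℝ, E)) (J' := 𝓘(ℝ, E)) rfl rfl
    (mdifferentiableAt_extChartAt_symm_of_mem hy).hasMFDerivAt).mfderiv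

/-- The charts are holomorphic, so the coordinate expression of `∂̄K` is a constant linear map
applied to that of `dK`; differentiating it only involves the Hessian of `K`. -/
theorem localRep_delBar (K : L → ℝ) {c : L} {y : E} (hy : y ∈ (extChartAt 𝓘(ℂ, E) c).target) :
    localRep c (delBar (E := E) K) y = part01L E (localRep c (realDiff (E := E) K) y) := by
  have h := mfderiv_extChartAt_symm_real hy
  have h1 : localRep c (delBar (E := E) K) y = ContinuousLinearMap.comp
      (part01 (E := E) (realDiff (E := E) K ((extChartAt 𝓘(ℝ, E) c).symm y))) _ :=
    congrArg (ContinuousLinearMap.comp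
      (part01 (E := E) (realDiff (E := E) K ((extChartAt 𝓘(ℝ, E) c).symm y)))) h
  have h2 : localRep c (realDiff (E := E) K) y = ContinuousLinearMap.comp
      (show E →L[ℝ] ℝ from realDiff (E := E) K ((extChartAt 𝓘(ℝ, E) c).symm y)) _ :=
    congrArg (ContinuousLinearMap.comp
      (show E →L[ℝ] ℝ from realDiff (E := E) K ((extChartAt 𝓘(ℝ, E) c).symm y))) h
  exact h1.trans ((part01_comp _ _).trans ((part01L_apply _).symm.trans
    (congrArg (part01L E) h2.symm)))

theorem localRep_negIDel (K : L → ℝ) {c : L} {y : E} (hy : y ∈ (extChartAt 𝓘(ℂ, E) c).target) :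
    localRep c (realCovector fun x => -Complex.I • del (E := E) K x) y
      = negIPart10L E (localRep c (realDiff (E := E) K) y) := by
  have h := mfderiv_extChartAt_symm_real hy
  have h2 : localRep c (realDiff (E := E) K) y = ContinuousLinearMap.comp
      (show E →L[ℝ] ℝ from realDiff (E := E) K ((extChartAt 𝓘(ℝ, E) c).symm y)) _ :=
    congrArg (ContinuousLinearMap.comp
      (show E →L[ℝ] ℝ from realDiff (E := E) K ((extChartAt 𝓘(ℝ, E) c).symm y))) h
  refine (localRep_realCovector _ _ hy).trans (Eq.trans ?_ (congrArg (negIPart10L E) h2).symm)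
  refine Eq.trans ?_ (negIPart10L_apply _).symm
  have h3 := part10_comp (E := E) (realDiff (E := E) K ((extChartAt 𝓘(ℝ, E) c).symm y))
    (mfderiv 𝓘(ℂ, E) 𝓘(ℂ, E) (extChartAt 𝓘(ℂ, E) c).symm y)
  refine Eq.trans ?_ (congrArg (fun ξ : E →L[ℂ] ℂ => realLinear (-Complex.I • ξ)) h3)
  refine ContinuousLinearMap.ext fun v => ?_
  rfl

theorem localRep_realDiff_eventuallyEq {K : L → ℝ} {x : L}
    (hK : ∀ᶠ z in 𝓝 x, MDifferentiableAt 𝓘(ℝ, E) 𝓘(ℝ) K z) :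
    localRep x (realDiff (E := E) K) =ᶠ[𝓝 (extChartAt 𝓘(ℝ, E) x x)]
      fderiv ℝ (K ∘ (extChartAt 𝓘(ℝ, E) x).symm) := by
  have : IsManifold 𝓘(ℝ, E) 1 L := by
    have : IsManifold 𝓘(ℂ, E) 1 L := IsManifold.of_le (n := ω) le_top
    exact isManifold_real L
  filter_upwards [extChartAt_target_mem_nhds (I := 𝓘(ℝ, E)) x,
    extChartAt_preimage_mem_nhds (I := 𝓘(ℝ, E)) hK] with y hy hyK
  have hyK' : MDifferentiableAt 𝓘(ℝ, E) 𝓘(ℝ) K ((extChartAt 𝓘(ℝ, E) x).symm y) := hyK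
  have h := HasMFDerivAt.comp y hyK'.hasMFDerivAt
    (mdifferentiableAt_extChartAt_symm_of_mem hy).hasMFDerivAt
  have h' : HasFDerivAt (K ∘ (extChartAt 𝓘(ℝ, E) x).symm)
      (localRep x (realDiff (E := E) K) y) y := h.hasFDerivAt
  exact h'.fderiv.symm

/-- `d(-i ∂K) = i ∂∂̄K`. -/
theorem extD_negIDel {K : L → ℝ} {x : L} (hK : ContMDiffAt 𝓘(ℝ, E) 𝓘(ℝ) 2 K x)
    (hK1 : ∀ᶠ z in 𝓝 x, MDifferentiableAt 𝓘(ℝ, E) 𝓘(ℝ) K z) :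
    extD 𝓘(ℝ, E) (oneForm 𝓘(ℝ, E) (realCovector fun x => -Complex.I • del (E := E) K x)) x
      = Complex.I • delDelBar (E := E) K x := by
  set k := K ∘ (extChartAt 𝓘(ℝ, E) x).symm with hk
  set y₀ := extChartAt 𝓘(ℝ, E) x x with hy₀
  have hk2 : ContDiffAt ℝ 2 k y₀ := by
    have h2 := (contMDiffAt_iff.1 hK).2
    rw [ModelWithCorners.range_eq_univ, contDiffWithinAt_univ] at h2
    exact h2
  have hsymm : IsSymmSndFDerivAt ℝ k y₀ :=
    hk2.isSymmSndFDerivAt (by simp)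
  have hD : HasFDerivAt (fderiv ℝ k) (fderiv ℝ (fderiv ℝ k) y₀) y₀ :=
    ((hk2.fderiv_right (m := 1) (by norm_num)).differentiableAt one_ne_zero).hasFDerivAt
  set D := fderiv ℝ (fderiv ℝ k) y₀ with hDdef
  have htgt := extChartAt_target_mem_nhds (I := 𝓘(ℂ, E)) x
  have h10 : HasFDerivAt (localRep x (realCovector fun x => -Complex.I • del (E := E) K x))
      ((negIPart10L E).comp D) y₀ := by
    refine ((negIPart10L E).hasFDerivAt.comp y₀ hD).congr_of_eventuallyEq ?_
    filter_upwards [htgt, localRep_realDiff_eventuallyEq hK1] with y hy hy'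
    rw [localRep_negIDel K hy, hy']
    rfl
  have h01 : HasFDerivAt (localRep x (delBar (E := E) K)) ((part01L E).comp D) y₀ := by
    refine ((part01L E).hasFDerivAt.comp y₀ hD).congr_of_eventuallyEq ?_
    filter_upwards [htgt, localRep_realDiff_eventuallyEq hK1] with y hy hy'
    rw [localRep_delBar K hy, hy']
    rfl
  have e10 : ∀ v w : E, (show E [⋀^Fin 2]→L[ℝ] ℂ from extD 𝓘(ℝ, E) (oneForm 𝓘(ℝ, E)
      (realCovector fun x => -Complex.I • del (E := E) K x)) x) ![v, w]
      = negIPart10L E (D v) w - negIPart10L E (D w) v := fun v w => by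
    refine (extDeriv_ofSubsingleton_apply h10.differentiableAt v w).trans ?_
    rw [h10.fderiv]
    rfl
  have e01 : ∀ v w : E, (show E [⋀^Fin 2]→L[ℝ] ℂ from extD 𝓘(ℝ, E) (oneForm 𝓘(ℝ, E)
      (delBar (E := E) K)) x) ![v, w]
      = part01L E (D v) w - part01L E (D w) v := fun v w => by
    refine (extDeriv_ofSubsingleton_apply h01.differentiableAt v w).trans ?_
    rw [h01.fderiv]
    rfl
  refine ContinuousAlternatingMap.ext fun u => ?_
  obtain ⟨v, w, rfl⟩ : ∃ v w : E, u = ![v, w] :=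
    ⟨u 0, u 1, by funext i; fin_cases i <;> rfl⟩
  refine (e10 v w).trans ?_
  have hJ : (mulI E : E → E) ∘ ![v, w] = ![Complex.I • v, Complex.I • w] := by
    funext i
    fin_cases i <;> rfl
  have hR : (show E [⋀^Fin 2]→L[ℝ] ℂ from Complex.I • delDelBar (E := E) K x) ![v, w]
      = Complex.I * ((1 / 2 : ℂ) *
        ((part01L E (D v) w - part01L E (D w) v)
        + (part01L E (D (Complex.I • v)) (Complex.I • w)
          - part01L E (D (Complex.I • w)) (Complex.I • v)))) := by
    rw [← e01 v w, ← e01 (Complex.I • v) (Complex.I • w), ← hJ]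
    rfl
  refine Eq.trans ?_ hR.symm
  -- With `D` the Hessian, symmetry reduces both sides to `-(D v (i w) - D w (i v)) / 2`.
  simp only [negIPart10L_apply, part01L_apply, part01_apply]
  change -Complex.I * part10 (D v) w - -Complex.I * part10 (D w) v = _
  simp only [part10_apply, smul_smul, Complex.I_mul_I, neg_smul, one_smul, map_neg]
  have s1 : D (Complex.I • v) w = D w (Complex.I • v) := hsymm _ _
  have s2 : D (Complex.I • w) v = D v (Complex.I • w) := hsymm _ _
  have s3 : D w v = D v w := hsymm _ _
  have s4 : D (Complex.I • w) (Complex.I • v) = D (Complex.I • v) (Complex.I • w) := hsymm _ _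
  rw [s1, s2, s3, s4]
  push_cast
  ring

end Dolbeault

/-! ### Graphs determine forms. -/

section Graph

variable {E : Type*} [NormedAddCommGroup E] [NormedSpace ℂ E]
  {Z L : Type*} [TopologicalSpace Z]
  [TopologicalSpace L] [ChartedSpace E L] [IsManifold 𝓘(ℂ, E) ω L]
  {φ : OpenPartialHomeomorph (Cotangent E L) Z} {𝓛 : Set Z}
  {η : (x : L) → TangentSpace 𝓘(ℂ, E) x →L[ℂ] ℂ}

theorem IsGraphOver.mem (h : IsGraphOver φ 𝓛 Set.univ η) (x : L) :
    formSection η x ∈ φ.source ∧ φ (formSection η x) ∈ 𝓛 := by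
  have hx : formSection η x ∈ {p : Cotangent E L | p ∈ φ.source ∧ φ p ∈ 𝓛 ∧ p.proj ∈ Set.univ} := by
    rw [show {p : Cotangent E L | p ∈ φ.source ∧ φ p ∈ 𝓛 ∧ p.proj ∈ Set.univ}
      = formSection η '' Set.univ from h]
    exact ⟨x, trivial, rfl⟩
  exact ⟨hx.1, hx.2.1⟩

/-- The part of `𝓛` over `U` is the graph of `η` restricted to `U`. A point of a graph remembers its
base point, so equal graphs have equal covectors. -/
theorem IsGraphOver.isGraphOver_iff (h : IsGraphOver φ 𝓛 Set.univ η) {U : Set L}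
    {η' : (x : L) → TangentSpace 𝓘(ℂ, E) x →L[ℂ] ℂ} :
    IsGraphOver φ 𝓛 U η' ↔ ∀ x ∈ U, η' x = η x := by
  have hU : {p : Cotangent E L | p ∈ φ.source ∧ φ p ∈ 𝓛 ∧ p.proj ∈ U} = formSection η '' U := by
    ext p
    constructor
    · rintro ⟨h1, h2, h3⟩
      have hp : p ∈ formSection η '' Set.univ := by
        rw [← show {p : Cotangent E L | p ∈ φ.source ∧ φ p ∈ 𝓛 ∧ p.proj ∈ Set.univ}
          = formSection η '' Set.univ from h]
        exact ⟨h1, h2, trivial⟩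
      obtain ⟨x, -, rfl⟩ := hp
      exact ⟨x, h3, rfl⟩
    · rintro ⟨x, hx, rfl⟩
      exact ⟨(h.mem x).1, (h.mem x).2, hx⟩
  unfold IsGraphOver
  rw [hU]
  constructor
  · intro heq x hx
    have hmem : formSection η' x ∈ formSection η '' U := heq ▸ ⟨x, hx, rfl⟩
    obtain ⟨z, -, hz⟩ := hmem
    obtain rfl : z = x := congrArg (fun p : Cotangent E L => p.proj) hz
    simp only [formSection, TotalSpace.mk.injEq, heq_eq_eq, true_and] at hz
    exact hz.symm
  · intro heq
    refine Set.image_congr fun x hx => ?_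
    simp only [formSection, heq x hx]

end Graph

/-! ### Uniqueness of primitives up to constants. -/

section Constant

variable {E : Type*} [NormedAddCommGroup E] [NormedSpace ℝ E]
  {M : Type*} [TopologicalSpace M] [ChartedSpace E M]

theorem exists_const_of_mfderiv_eq [IsManifold 𝓘(ℝ, E) 1 M] {U : Set M} (hU : IsOpen U)
    (hUc : IsPreconnected U) {K K' : M → ℝ} {a : (x : M) → TangentSpace 𝓘(ℝ, E) x →L[ℝ] ℝ}
    (hK : ∀ x ∈ U, HasMFDerivAt 𝓘(ℝ, E) 𝓘(ℝ) K x (a x))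
    (hK' : ∀ x ∈ U, HasMFDerivAt 𝓘(ℝ, E) 𝓘(ℝ) K' x (a x)) :
    ∃ c : ℝ, ∀ x ∈ U, K' x = K x + c := by
  have hloc : ∀ x ∈ U, ∀ᶠ y in 𝓝 x, (K' - K) y = (K' - K) x := by
    intro x hx
    refine eventually_eq_of_hasMFDerivAt_zero (E := E) ?_
    filter_upwards [hU.mem_nhds hx] with z hz
    have h1 := (hK' z hz).sub (hK z hz)
    rwa [sub_self] at h1
  rcases U.eq_empty_or_nonempty with rfl | ⟨x₀, hx₀⟩
  · exact ⟨0, by simp⟩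
  refine ⟨(K' - K) x₀, fun x hx => ?_⟩
  have hpc : PreconnectedSpace U := Subtype.preconnectedSpace hUc
  have hlc : IsLocallyConstant fun y : U => (K' - K) y := by
    rw [IsLocallyConstant.iff_eventually_eq]
    intro y
    exact continuous_subtype_val.continuousAt.eventually (hloc y y.2)
  have h := hlc.apply_eq_of_preconnectedSpace ⟨x, hx⟩ ⟨x₀, hx₀⟩
  simp only [Pi.sub_apply] at h ⊢
  linarith

end Constant

end GKPotential

end

/-! ### The generalized Kähler potential. -/

theorem theorem5p1
    {E Ep Em EL : Type*}
    [NormedAddCommGroup E] [NormedSpace ℂ E] [FiniteDimensional ℂ E]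
    [NormedAddCommGroup Ep] [NormedSpace ℂ Ep] [FiniteDimensional ℂ Ep]
    [NormedAddCommGroup Em] [NormedSpace ℂ Em] [FiniteDimensional ℂ Em]
    [NormedAddCommGroup EL] [NormedSpace ℂ EL] [FiniteDimensional ℂ EL]
    {Z Xp Xm L : Type*}
    [TopologicalSpace Z] [T2Space Z] [SecondCountableTopology Z]
    [ChartedSpace E Z] [IsManifold 𝓘(ℂ, E) ω Z]
    [TopologicalSpace Xp] [T2Space Xp] [SecondCountableTopology Xp]
    [ChartedSpace Ep Xp] [IsManifold 𝓘(ℂ, Ep) ω Xp]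
    [TopologicalSpace Xm] [T2Space Xm] [SecondCountableTopology Xm]
    [ChartedSpace Em Xm] [IsManifold 𝓘(ℂ, Em) ω Xm]
    [TopologicalSpace L] [T2Space L] [SecondCountableTopology L]
    [ChartedSpace EL L] [IsManifold 𝓘(ℂ, EL) ω L]
    (Ω : GKPotential.DiffForm 𝓘(ℂ, E) Z ℂ 2)
    (σp : GKPotential.BivectorField Ep Xp) (σm : GKPotential.BivectorField Em Xm)
    (πp : Z → Xp) (πm : Z → Xm)
    (hZ : GKPotential.IsMoritaEquivalence Ω σp σm πp πm)
    (𝓛 : Set Z) (h𝓛 : GKPotential.IsBraneBisection (Ep := Ep) (Em := Em) Ω πp πm 𝓛)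
    (φ : OpenPartialHomeomorph (GKPotential.Cotangent EL L) Z)
    (hφ : GKPotential.IsDarbouxChart Ω φ) (hgen : GKPotential.IsGeneric φ 𝓛)
    (U : Set L) (hU : IsOpen U) (hUsc : SimplyConnectedSpace U) :
    ∃ K : L → ℝ,
      ContMDiffOn 𝓘(ℝ, EL) 𝓘(ℝ) ∞ K U ∧
      GKPotential.IsGraphOver φ 𝓛 U (fun x => -Complex.I • GKPotential.del (E := EL) K x) ∧
      (∀ K' : L → ℝ, ContMDiffOn 𝓘(ℝ, EL) 𝓘(ℝ) ∞ K' U →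
        (GKPotential.IsGraphOver φ 𝓛 U (fun x => -Complex.I • GKPotential.del (E := EL) K' x) ↔
          ∃ c : ℝ, ∀ x ∈ U, K' x = K x + c)) ∧
      ∀ x ∈ U,
        GKPotential.pullback 𝓘(ℝ, EL) 𝓘(ℝ, E)
            (fun y => φ (GKPotential.formSection
              (fun x => -Complex.I • GKPotential.del (E := EL) K x) y))
            (GKPotential.realForm Ω) x
          = Complex.I • GKPotential.delDelBar (E := EL) K x := by
  have hLR : IsManifold 𝓘(ℝ, EL) ∞ L := by
    have : IsManifold 𝓘(ℂ, EL) ∞ L := IsManifold.of_le (n := ω) le_top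
    exact GKPotential.isManifold_real L
  have hLR1 : IsManifold 𝓘(ℝ, EL) 1 L := IsManifold.of_le (n := ∞) (by norm_cast)
  obtain ⟨η, hη, hgraph⟩ := hgen
  have hη1 : ∀ x, ContMDiffAt 𝓘(ℝ, EL) (𝓘(ℝ, EL).prod 𝓘(ℝ, EL →L[ℂ] ℂ)) 1
      (GKPotential.formSection η) x := fun x => (hη x).of_le (by norm_cast)
  -- The primitive sought is that of `a = -2 Im η`, the real covector field with `-i a^{1,0} = η`.
  let A : ℂ →L[ℝ] ℝ := (-2 : ℝ) • Complex.imCLM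
  let a : (x : L) → TangentSpace 𝓘(ℝ, EL) x →L[ℝ] ℝ :=
    fun x => A.comp (GKPotential.realCovector η x)
  have hηloc : ∀ x, ContDiffAt ℝ ∞ (GKPotential.localRep x (GKPotential.realCovector η))
      (extChartAt 𝓘(ℝ, EL) x x) := fun x =>
    GKPotential.contDiffAt_localRep_realCovector (hη x)
  have haloc : ∀ x ∈ U, ContDiffAt ℝ ∞ (GKPotential.localRep x a) (extChartAt 𝓘(ℝ, EL) x x) :=
    fun x _ => (ContinuousLinearMap.compL ℝ EL ℂ ℝ A).contDiff.contDiffAt.comp _ (hηloc x)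
  -- `da = -2 Im dη`, and `dη` is the pullback of `Ω` to the graph, whose imaginary part vanishes on
  -- the Lagrangian `𝓛`.
  have hclosed : ∀ x ∈ U, GKPotential.extD 𝓘(ℝ, EL) (GKPotential.oneForm 𝓘(ℝ, EL) a) x = 0 := by
    intro x _
    refine ContinuousAlternatingMap.ext fun u => ?_
    obtain ⟨v, w, rfl⟩ : ∃ v w : EL, u = ![v, w] :=
      ⟨u 0, u 1, by funext i; fin_cases i <;> rfl⟩
    refine (GKPotential.extD_oneForm_comp_apply A ((hηloc x).differentiableAt (by simp))
      v w).trans ?_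
    have him := GKPotential.im_pullback_eq_zero_of_mem_lagrangian (Ω := Ω)
      hZ.fibration_plus.holomorphic h𝓛.1
      (g := fun y => φ (GKPotential.formSection η y)) (fun y => (hgraph.mem y).2)
      (GKPotential.hasMFDerivAt_darboux_formSection hφ (hη1 x)
        (hgraph.mem x).1).mdifferentiableAt v w
    rw [GKPotential.pullback_darboux_formSection hφ (hη1 x) (hgraph.mem x).1] at him
    exact (congrArg (fun t : ℝ => (-2 : ℝ) • t) him).trans (smul_zero _)
  obtain ⟨K, hKs, hKd⟩ := GKPotential.exists_primitive hU haloc hclosed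
  have hdel : ∀ K' : L → ℝ, ∀ x, mfderiv 𝓘(ℝ, EL) 𝓘(ℝ) K' x = a x →
      -Complex.I • GKPotential.del (E := EL) K' x = η x := by
    intro K' x hx
    refine Eq.trans ?_ (GKPotential.neg_I_smul_part10 (E := EL) (η x))
    exact congrArg (fun b : EL →L[ℝ] ℝ => -Complex.I • GKPotential.part10 (E := EL) b) hx
  have hKη : ∀ x ∈ U, -Complex.I • GKPotential.del (E := EL) K x = η x :=
    fun x hx => hdel K x (hKd x hx).mfderiv
  refine ⟨K, hKs, hgraph.isGraphOver_iff.2 hKη, fun K' hK' => ?_, fun x hx => ?_⟩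
  · rw [hgraph.isGraphOver_iff]
    constructor
    · intro h
      refine GKPotential.exists_const_of_mfderiv_eq hU
        (isPreconnected_iff_preconnectedSpace.2 inferInstance) hKd fun x hx => ?_
      have hd := ((hK'.contMDiffAt (hU.mem_nhds hx)).mdifferentiableAt (by simp)).hasMFDerivAt
      -- Both `dK'` and `a` have `(1,0)`-part `i η`, and a real covector is determined by its
      -- `(1,0)`-part.
      have hinj : mfderiv 𝓘(ℝ, EL) 𝓘(ℝ) K' x = a x := by
        refine GKPotential.part10_injective (E := EL) ?_
        have h1 := (h x hx).trans (GKPotential.neg_I_smul_part10 (E := EL) (η x)).symm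
        exact smul_right_injective (EL →L[ℂ] ℂ) (neg_ne_zero.2 Complex.I_ne_zero) h1
      rwa [hinj] at hd
    · rintro ⟨c, hc⟩ x hx
      refine hdel K' x (HasMFDerivAt.mfderiv ?_)
      have h1 := (hKd x hx).add (hasMFDerivAt_const (I := 𝓘(ℝ, EL)) (I' := 𝓘(ℝ)) c x)
      have h2 : a x = a x + 0 := (add_zero (M := EL →L[ℝ] ℝ) (a x)).symm
      rw [h2]
      refine h1.congr_of_eventuallyEq ?_
      filter_upwards [hU.mem_nhds hx] with y hy
      exact hc y hy
  -- The sections `-i ∂K` and `η` agree only over `U`; agreement near `x` suffices to transfer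
  -- smoothness and the identity between the pullback of `Ω` and the exterior derivative.
  · have heq : GKPotential.formSection (fun x => -Complex.I • GKPotential.del (E := EL) K x)
        =ᶠ[𝓝 x] GKPotential.formSection η := by
      filter_upwards [hU.mem_nhds hx] with y hy
      simp only [GKPotential.formSection, hKη y hy]
    have hsrc : GKPotential.formSection
        (fun x => -Complex.I • GKPotential.del (E := EL) K x) x ∈ φ.source := by
      rw [heq.self_of_nhds]
      exact (hgraph.mem x).1
    rw [GKPotential.pullback_darboux_formSection hφ ((hη1 x).congr_of_eventuallyEq heq) hsrc]
    refine GKPotential.extD_negIDel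
      ((hKs.contMDiffAt (hU.mem_nhds hx)).of_le (by norm_cast)) ?_
    filter_upwards [hU.mem_nhds hx] with z hz
    exact (hKd z hz).mdifferentiableAt
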